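/- Let $n\ge 2$ and let $F_n=A_1*\cdots*A_k*B$ ($k\ge 0$), where $A_j$ is free with basis $y^j_1,\dots,y^j_{s(j)}$, $s(j)\ge 1$, and $B$ is free of rank $n-\sum_{j=1}^k s(j)$. Let $m$ be the number of $j$ with $s(j)=1$. Let $R_n(\mathcal A)$ be the relative rose: a central vertex with $n-\sum_j s(j)$ loops and $k$ stems, with a wedge of $s(j)$ circles $C_1^j,\dots,C_{s(j)}^j$ attached at the end of the $j$-th stem; its fundamental group is $F_n$. An $(\mathcal A,n)$-graph is a finite connected graph $\Gamma$ of rank $n$ with all vertices of valence at least $3$ (separating edges are allowed), together with embeddings $l_j:\bigvee_{i=1}^{s(j)}S^1\to\Gamma$, $1\le j\le k$, such that any two of the images (the wedge cycles) meet in at most a point and their dual graph is a forest; the dual graph has one vertex for each wedge cycle, one vertex for each point in which at least two wedge cycles meet, and an edge between a point and each wedge cycle containing it. A marking is a homotopy equivalence $\phi:R_n(\mathcal A)\to\Gamma$ that restricts to $l_j$ on $\bigvee_i C_i^j$ for all $j$. The relative outer space $\mathrm{CV}_n(\mathcal A)$ is the set of marked $(\mathcal A,n)$-graphs with positive edge lengths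 such that each circle $\phi(C_i^j)$ has length $1$ and the total length of the edges outside the wedge cycles is $1$ (no condition if there are no such edges), modulo isometries $h:\Gamma_1\to\Gamma_2$ with $h(\phi_1(C_i^j))=\phi_2(C_i^j)$ for all $i,j$ and $h\circ\phi_1\simeq\phi_2$. The lengths on a fixed marked graph form an open polysimplex (a product of open simplices), and $\mathrm{CV}_n(\mathcal A)$ is the union of these open polysimplices. Let $\mathrm{CV}^{\mathrm{red}}_n(\mathcal A)\subseteq \mathrm{CV}_n(\mathcal A)$ be the reduced relative outer space, which consists of the graphs without separating edges. The dimension of a union of open polysimplices is the maximum of their dimensions. (1) If $n-\sum_{j=1}^k s(j)\ge 1$, then $$\dim \mathrm{CV}_n(\mathcal A)=\dim \mathrm{CV}^{\mathrm{red}}_n(\mathcal A)=3n+3k-3\sum_{j=1}^k s(j)-4-m.$$ (2) If $n=\sum_{j=1}^k s(j)$, then, modulo separating edges, the dimension is $$\dim \mathrm{CV}^{\mathrm{red}}_n(\mathcal A)=3n+2k-3\sum_{j=1}^k s(j)-2-m.$$ -/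

import Mathlib

namespace RelOuter

/-- A finite graph (1-dimensional CW complex). Loops and multiple edges are allowed; every edge
carries an auxiliary orientation. -/
structure FinGraph where
  V : Type
  E : Type
  [finV : Fintype V]
  [finE : Fintype E]
  src : E → V
  tgt : E → V

attribute [instance] FinGraph.finV FinGraph.finE

namespace FinGraph

variable (Γ : FinGraph)

/-- An oriented edge: `(e, true)` is `e` with its orientation, `(e, false)` is its reverse.
Lists of oriented edges are therefore also words representing elements of `FreeGroup Γ.E`. -/
abbrev Dart : Type := Γ.E × Bool

def start (d : Γ.Dart) : Γ.V := if d.2 then Γ.src d.1 else Γ.tgt d.1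

def finish (d : Γ.Dart) : Γ.V := if d.2 then Γ.tgt d.1 else Γ.src d.1

/-- `Γ.IsPath u L v`: the list of oriented edges `L` is an edge path from `u` to `v`. -/
def IsPath : Γ.V → List Γ.Dart → Γ.V → Prop
  | u, [], v => u = v
  | u, d :: L, v => Γ.start d = u ∧ IsPath (Γ.finish d) L v

def Connected : Prop := Nonempty Γ.V ∧ ∀ u v, ∃ L, Γ.IsPath u L v

/-- The valence of a vertex: the number of half edges at it (a loop counts twice). -/
noncomputable def valence (v : Γ.V) : ℕ :=
  {e : Γ.E | Γ.src e = v}.ncard + {e : Γ.E | Γ.tgt e = v}.ncard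

/-- An edge is separating if its endpoints are not joined by a path avoiding it. -/
def IsSeparating (e : Γ.E) : Prop :=
  ¬ ∃ L, Γ.IsPath (Γ.src e) L (Γ.tgt e) ∧ ∀ d ∈ L, d.1 ≠ e

variable {Γ}

theorem IsPath.append {u v w : Γ.V} {L M : List Γ.Dart} (hL : Γ.IsPath u L v)
    (hM : Γ.IsPath v M w) : Γ.IsPath u (L ++ M) w := by
  induction L generalizing u with
  | nil =>
    have h : u = v := hL
    subst h
    exact hM
  | cons d L ih => exact ⟨hL.1, ih hL.2⟩

theorem IsPath.invRev {u v : Γ.V} {L : List Γ.Dart} (hL : Γ.IsPath u L v) :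
    Γ.IsPath v (FreeGroup.invRev L) u := by
  induction L generalizing u with
  | nil => exact Eq.symm hL
  | cons d L ih =>
    have h2 : FreeGroup.invRev (d :: L) = FreeGroup.invRev L ++ [(d.1, !d.2)] := by
      simp [FreeGroup.invRev]
    rw [h2]
    refine (ih hL.2).append ⟨?_, ?_⟩
    · cases h : d.2 <;> simp [start, finish, h]
    · have h3 := hL.1
      cases h : d.2 <;> simpa [IsPath, start, finish, h] using h3

variable (Γ)

/-- The fundamental group of `Γ` at `v`: closed edge paths at `v` modulo insertion and deletion of
backtrackings `d d⁻¹`. Two edge paths with the same endpoints are homotopic relative to the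
endpoints exactly when they have the same free reduction, so this is the subgroup of the free group
on the edges that consists of the classes of closed edge paths at `v`. -/
def pi1 (v : Γ.V) : Subgroup (FreeGroup Γ.E) where
  carrier := {g | ∃ L, Γ.IsPath v L v ∧ FreeGroup.mk L = g}
  mul_mem' := by
    rintro _ _ ⟨L, hL, rfl⟩ ⟨M, hM, rfl⟩
    exact ⟨L ++ M, hL.append hM, by simp⟩
  one_mem' := ⟨[], rfl, rfl⟩
  inv_mem' := by
    rintro _ ⟨L, hL, rfl⟩
    exact ⟨FreeGroup.invRev L, hL.invRev, by simp⟩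

end FinGraph

/-- An `(A_1, …, A_k, n)`-graph, where `A_j` is free of rank `s j`: a finite connected graph of
rank `n`, all of whose vertices have valence at least `3`, with an embedded wedge of `s j` circles
for each `j`, such that two different wedges meet in at most a point and the dual graph of the
wedges is a forest. The circle `(j, i)` is given by the closed edge path `petal j i` at the
basepoint `base j`. -/
structure RelGraph (n : ℕ) {k : ℕ} (s : Fin k → ℕ) extends FinGraph where
  connected : toFinGraph.Connected
  rank_eq : Fintype.card E + 1 = Fintype.card V + n
  three_le_valence : ∀ v, 3 ≤ toFinGraph.valence v
  base : Fin k → V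
  petal : (j : Fin k) → Fin (s j) → List toFinGraph.Dart
  petal_isPath : ∀ j i, toFinGraph.IsPath (base j) (petal j i) (base j)
  petal_ne_nil : ∀ j i, petal j i ≠ []
  /-- Each petal is an embedded circle: no vertex and no edge is passed twice. -/
  petal_vertices_nodup : ∀ j i, ((petal j i).map toFinGraph.start).Nodup
  petal_edges_nodup : ∀ j i, ((petal j i).map Prod.fst).Nodup
  /-- Two petals of the same wedge meet only in the basepoint. -/
  petal_vertices_inter : ∀ j i i', i ≠ i' → ∀ v, v ∈ (petal j i).map toFinGraph.start →
    v ∈ (petal j i').map toFinGraph.start → v = base j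
  petal_edges_disjoint : ∀ j i i', i ≠ i' →
    List.Disjoint ((petal j i).map Prod.fst) ((petal j i').map Prod.fst)
  /-- Two different wedges meet in at most a point. -/
  wedge_edges_disjoint : ∀ j j', j ≠ j' → ∀ i i',
    List.Disjoint ((petal j i).map Prod.fst) ((petal j' i').map Prod.fst)
  wedge_vertices_inter : ∀ j j', j ≠ j' →
    {v : V | (∃ i, v ∈ (petal j i).map toFinGraph.start) ∧
      ∃ i, v ∈ (petal j' i).map toFinGraph.start}.Subsingleton
  /-- The dual graph: one vertex for each wedge, one for each point in which at least two wedges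
  meet, and an edge whenever such a point lies on a wedge. -/
  dual_isAcyclic : (SimpleGraph.fromRel
    (fun (a b : Fin k ⊕ {v : V // ∃ j j', j ≠ j' ∧
        (∃ i, v ∈ (petal j i).map toFinGraph.start) ∧
        ∃ i, v ∈ (petal j' i).map toFinGraph.start}) =>
      ∃ j w, a = Sum.inl j ∧ b = Sum.inr w ∧
        ∃ i, w.1 ∈ (petal j i).map toFinGraph.start)).IsAcyclic

/-- A basis of `F_n = A_1 * ⋯ * A_k * B`: the elements `y_i^j` and the elements `x_i`. -/
abbrev Gen (n : ℕ) {k : ℕ} (s : Fin k → ℕ) : Type :=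
  (Σ j : Fin k, Fin (s j)) ⊕ Fin (n - ∑ j, s j)

/-- The elements of the free group on the edges to which the basis of `F_n` is sent by a map from
the relative rose: `y_i^j` is represented by the `j`-th stem followed by the petal `(j, i)` and the
reversed stem, and `x_i` by the `i`-th loop. -/
def RelGraph.mark {n k : ℕ} {s : Fin k → ℕ} (G : RelGraph n s) (stem : Fin k → List G.Dart)
    (loop : Fin (n - ∑ j, s j) → List G.Dart) : Gen n s → FreeGroup G.E :=
  Sum.elim
    (fun p => FreeGroup.mk (stem p.1) * FreeGroup.mk (G.petal p.1 p.2) *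
      (FreeGroup.mk (stem p.1))⁻¹)
    (fun i => FreeGroup.mk (loop i))

/-- A marked `(A_1, …, A_k, n)`-graph. The marking is a cellular map `φ` from the relative rose
`R_n(A)`, which restricts to the given embeddings of the wedges: it sends the central vertex to
`center`, the stem `f_j` to the edge path `stem j` and the loop `e_i` to the closed edge path
`loop i`. It is a homotopy equivalence: it induces an isomorphism from `F_n`, the fundamental group
of the relative rose, onto the fundamental group of the graph. -/
structure MarkedGraph (n : ℕ) {k : ℕ} (s : Fin k → ℕ) extends RelGraph n s where
  center : V
  stem : Fin k → List toFinGraph.Dart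
  stem_isPath : ∀ j, toFinGraph.IsPath center (stem j) (base j)
  loop : Fin (n - ∑ j, s j) → List toFinGraph.Dart
  loop_isPath : ∀ i, toFinGraph.IsPath center (loop i) center
  mark_injective : Function.Injective (FreeGroup.lift (toRelGraph.mark stem loop))
  mark_range : (FreeGroup.lift (toRelGraph.mark stem loop)).range = toFinGraph.pi1 center

namespace MarkedGraph

variable {n k : ℕ} {s : Fin k → ℕ} (G : MarkedGraph n s)

/-- The edges that do not lie on any wedge cycle. -/
def outside : Set G.E := {e | ∀ j i, e ∉ (G.petal j i).map Prod.fst}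

open Classical in
/-- The open polysimplex of length functions on a marked graph: lengths are positive, each circle
`φ(C_i^j)` has length `1`, and the relative volume, i.e. the total length of the edges outside the
wedge cycles, is `1` (no condition if there are no such edges). -/
def polysimplex : Set (G.E → ℝ) :=
  {l | (∀ e, 0 < l e) ∧ (∀ j i, ((G.petal j i).map fun d => l d.1).sum = 1) ∧
    (G.outside.Nonempty → ∑ e with e ∈ G.outside, l e = 1)}

/-- The dimension of the open polysimplex, as the dimension of its affine hull. -/
noncomputable def polysimplexDim : ℕ := Module.finrank ℝ (vectorSpan ℝ G.polysimplex)

end MarkedGraph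

/-- A marked metric graph, normalized as required for a point of the relative outer space. -/
structure MarkedMetricGraph (n : ℕ) {k : ℕ} (s : Fin k → ℕ) extends MarkedGraph n s where
  length : E → ℝ
  length_mem : length ∈ toMarkedGraph.polysimplex

/-- The equivalence of marked metric graphs: there is an isometry `h` (a graph isomorphism
preserving lengths; `flip e` records whether it reverses the auxiliary orientation of `e`) that
carries each circle `φ₁(C_i^j)` to `φ₂(C_i^j)` and such that `h ∘ φ₁` is homotopic to `φ₂`. The
path `t` is the track of the central vertex under the homotopy. -/
def MarkedMetricGraph.Equivalent {n k : ℕ} {s : Fin k → ℕ} (G H : MarkedMetricGraph n s) : Prop :=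
  ∃ (hV : G.V ≃ H.V) (hE : G.E ≃ H.E) (flip : G.E → Bool),
    (∀ e, H.start (hE e, !flip e) = hV (G.src e) ∧ H.finish (hE e, !flip e) = hV (G.tgt e)) ∧
    (∀ e, H.length (hE e) = G.length e) ∧
    (∀ j i e, hE e ∈ (H.petal j i).map Prod.fst ↔ e ∈ (G.petal j i).map Prod.fst) ∧
    ∃ t, H.IsPath (hV G.center) t H.center ∧
      ∀ x, FreeGroup.lift (fun e => FreeGroup.mk [(hE e, !flip e)]) (G.mark G.stem G.loop x) =
        FreeGroup.mk t * H.mark H.stem H.loop x * (FreeGroup.mk t)⁻¹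

/-- The relative outer space `CV_n(A_1, …, A_k)`, where `A_j` has rank `s j`. -/
def RelOuterSpace (n : ℕ) {k : ℕ} (s : Fin k → ℕ) : Type 1 :=
  Quot (MarkedMetricGraph.Equivalent (n := n) (s := s))

namespace RelOuterSpace

variable {n k : ℕ} {s : Fin k → ℕ}

/-- The reduced part of the relative outer space: the graphs without separating edges. -/
def reduced (n : ℕ) {k : ℕ} (s : Fin k → ℕ) : Set (RelOuterSpace n s) :=
  {x | ∃ G : MarkedMetricGraph n s, (∀ e, ¬ G.IsSeparating e) ∧ x = Quot.mk _ G}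

/-- The open polysimplex in the relative outer space obtained by varying the lengths of the edges
of a marked graph. -/
def openPolysimplex (G : MarkedGraph n s) : Set (RelOuterSpace n s) :=
  {x | ∃ (l : G.E → ℝ) (hl : l ∈ G.polysimplex), x = Quot.mk _ ⟨G, l, hl⟩}

/-- The dimension of a union `X` of open polysimplices of the relative outer space: the supremum
of their dimensions. -/
noncomputable def dim (X : Set (RelOuterSpace n s)) : WithBot ℕ∞ :=
  ⨆ (G : MarkedGraph n s) (_ : openPolysimplex G ⊆ X), ((G.polysimplexDim : ℕ∞) : WithBot ℕ∞)

end RelOuterSpace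

end RelOuter

/-! ### Dimension of a polysimplex with prescribed blocks. -/

namespace RelOuter

/-! A normalized polysimplex has one linear constraint per block of edges, the blocks being the
petals and, if nonempty, the set of edges outside the wedges. So its dimension is the number of
edges minus the number of blocks (`finrank_vectorSpan_blocks`), and the problem is to maximize the
number of edges, or equivalently of vertices, since `E - V = n - 1`.

If `n > ∑ s j`, there are edges outside the wedges, because a union of wedges with a forest as dual
graph has rank at most `∑ s j`. A vertex carrying basepoints has valence at least `∑ 2 s j` over
these wedges, and every vertex has valence at least 3. Summing valences gives `card_edges_le`.
Equality is reached by a ring of wedges and digons, all of whose vertices are trivalent except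
basepoints of valence `2 s j`. It has no separating edges, so the full and the reduced dimension
agree.

If `n = ∑ s j`, a non-separating edge outside the wedges would give one more independent cycle
(`rank_of_not_isSeparating`), so a reduced graph is the union of its wedges. Each vertex is then a
meeting point, of which the forest allows at most `k - 1`, or the basepoint of a wedge with at least
two petals. The dimension is `V - 1`, and a star of wedges attains the bound.

To realize the two examples as marked graphs, a spanning tree missing exactly one edge of each petal
is used: the remaining edges give a free basis of the fundamental group that contains the petals
(`exists_marking`). -/

theorem exists_blocks_pos {E B : Type*} [Fintype E] [DecidableEq B] (f : E → B)
    (hf : Function.Surjective f) :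
    ∃ l : E → ℝ, (∀ e, 0 < l e) ∧ ∀ b, ∑ e with f e = b, l e = 1 := by
  have hcard : ∀ e, 0 < ((Finset.univ.filter fun e' => f e' = f e).card : ℝ) := fun e => by
    rw [Nat.cast_pos, Finset.card_pos]
    exact ⟨e, by simp⟩
  -- The uniform distribution on each fibre.
  refine ⟨fun e => 1 / ((Finset.univ.filter fun e' => f e' = f e).card : ℝ),
    fun e => one_div_pos.mpr (hcard e), fun b => ?_⟩
  obtain ⟨e₀, rfl⟩ := hf b
  rw [Finset.sum_congr rfl
    (g := fun _ => 1 / ((Finset.univ.filter fun e' => f e' = f e₀).card : ℝ))]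
  · rw [Finset.sum_const, nsmul_eq_mul]
    exact mul_one_div_cancel (hcard e₀).ne'
  · intro e he
    have : f e = f e₀ := by simpa using he
    simp only [this]

open Module in
/-- The dimension of an open polysimplex whose blocks are the fibres of `f`. -/
theorem finrank_vectorSpan_blocks {E B : Type*} [Fintype E] [Fintype B] [DecidableEq B]
    (f : E → B) (hf : Function.Surjective f) :
    finrank ℝ (vectorSpan ℝ {l : E → ℝ | (∀ e, 0 < l e) ∧ ∀ b, ∑ e with f e = b, l e = 1})
      + Fintype.card B = Fintype.card E := by
  classical
  let C : (E → ℝ) →ₗ[ℝ] (B → ℝ) :=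
    { toFun := fun l b => ∑ e with f e = b, l e
      map_add' := fun l l' => by ext b; simp [Finset.sum_add_distrib]
      map_smul' := fun c l => by ext b; simp [Finset.mul_sum] }
  have hC : ∀ l b, C l b = ∑ e with f e = b, l e := fun _ _ => rfl
  have hsurj : Function.Surjective C := by
    obtain ⟨g, hg⟩ := hf.hasRightInverse
    intro y
    refine ⟨fun e => if g (f e) = e then y (f e) else 0, ?_⟩
    ext b
    rw [hC, Finset.sum_eq_single (g b)]
    · simp [hg b]
    · intro e he hne
      have : f e = b := by simpa using he
      rw [if_neg]
      rw [this]
      exact fun h => hne h.symm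
    · intro h
      simp [hg b] at h
  -- Positivity is an open condition, so the nonempty polysimplex spans the whole affine space cut
  -- out by the block sums, whose direction is `ker C`.
  have hker : vectorSpan ℝ {l : E → ℝ | (∀ e, 0 < l e) ∧ ∀ b, ∑ e with f e = b, l e = 1}
      = LinearMap.ker C := by
    apply le_antisymm
    · rw [vectorSpan_def, Submodule.span_le]
      rintro _ ⟨l, hl, l', hl', rfl⟩
      change C (l - l') = 0
      rw [map_sub, sub_eq_zero]
      ext b
      rw [hC, hC, hl.2, hl'.2]
    · intro v hv
      obtain ⟨l₀, hl₀, hl₀C⟩ := exists_blocks_pos f hf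
      have hpos : ∃ ε : ℝ, 0 < ε ∧ ∀ e, 0 < l₀ e + ε * v e := by
        have h1 : ∀ e, ∀ᶠ ε in nhdsWithin (0 : ℝ) (Set.Ioi 0), 0 < l₀ e + ε * v e := by
          intro e
          have hc : Continuous fun ε : ℝ => l₀ e + ε * v e := by fun_prop
          have := hc.tendsto 0
          simp only [zero_mul, add_zero] at this
          exact (this.eventually (lt_mem_nhds (hl₀ e))).filter_mono nhdsWithin_le_nhds
        obtain ⟨ε, h2, h3⟩ := ((Filter.eventually_all.mpr h1).and self_mem_nhdsWithin).exists
        exact ⟨ε, h3, h2⟩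
      obtain ⟨ε, hε, hle⟩ := hpos
      have hmem : l₀ + ε • v ∈
          {l : E → ℝ | (∀ e, 0 < l e) ∧ ∀ b, ∑ e with f e = b, l e = 1} := by
        refine ⟨fun e => by simpa using hle e, fun b => ?_⟩
        have h1 : C (l₀ + ε • v) = C l₀ := by
          rw [map_add, map_smul, LinearMap.mem_ker.mp hv, smul_zero, add_zero]
        have := congrFun h1 b
        rwa [hC, hC, hl₀C] at this
      have := vsub_mem_vectorSpan ℝ hmem (show l₀ ∈ _ from ⟨hl₀, hl₀C⟩)
      rw [vsub_eq_sub, add_sub_cancel_left] at this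
      exact (Submodule.smul_mem_iff _ hε.ne').mp this
  rw [hker]
  have h1 := C.finrank_range_add_finrank_ker
  rw [LinearMap.range_eq_top.mpr hsurj, finrank_top, finrank_fintype_fun_eq_card,
    finrank_fintype_fun_eq_card] at h1
  omega

/-! ### Edge paths and valences. -/

namespace FinGraph

variable {Γ : FinGraph}

/-- The reversed oriented edge. -/
def rev (d : Γ.Dart) : Γ.Dart := (d.1, !d.2)

@[simp] theorem rev_rev (d : Γ.Dart) : rev (rev d) = d := by simp [rev]

@[simp] theorem start_rev (d : Γ.Dart) : Γ.start (rev d) = Γ.finish d := by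
  cases h : d.2 <;> simp [start, finish, rev, h]

@[simp] theorem finish_rev (d : Γ.Dart) : Γ.finish (rev d) = Γ.start d := by
  cases h : d.2 <;> simp [start, finish, rev, h]

theorem rev_ne (d : Γ.Dart) : rev d ≠ d := fun h => by
  have := congrArg Prod.snd h
  simp [rev] at this

theorem eq_or_eq_rev {d d' : Γ.Dart} (h : d.1 = d'.1) : d' = d ∨ d' = rev d := by
  obtain ⟨e, b⟩ := d
  obtain ⟨e', b'⟩ := d'
  obtain rfl : e = e' := h
  cases b <;> cases b' <;> simp [rev]

theorem rev_injective : Function.Injective (rev (Γ := Γ)) :=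
  Function.LeftInverse.injective rev_rev

theorem IsPath.of_append {u w : Γ.V} {L M : List Γ.Dart} (h : Γ.IsPath u (L ++ M) w) :
    ∃ v, Γ.IsPath u L v ∧ Γ.IsPath v M w := by
  induction L generalizing u with
  | nil => exact ⟨u, rfl, h⟩
  | cons d L ih =>
    obtain ⟨v, h1, h2⟩ := ih h.2
    exact ⟨v, ⟨h.1, h1⟩, h2⟩

theorem isPath_singleton (d : Γ.Dart) : Γ.IsPath (Γ.start d) [d] (Γ.finish d) := ⟨rfl, rfl⟩

theorem IsPath.ofFn {m : ℕ} (d : Fin m → Γ.Dart) (f : ℕ → Γ.V)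
    (h1 : ∀ i, Γ.start (d i) = f i) (h2 : ∀ i, Γ.finish (d i) = f (i + 1)) :
    Γ.IsPath (f 0) (List.ofFn d) (f m) := by
  induction m generalizing f with
  | zero => simp [IsPath]
  | succ m ih =>
    rw [List.ofFn_succ]
    refine ⟨h1 0, ?_⟩
    rw [h2 0]
    have := ih (fun i => d i.succ) (fun i => f (i + 1)) (fun i => by simpa using h1 i.succ)
      (fun i => by simpa using h2 i.succ)
    simpa using this

theorem IsPath.map_start {u v : Γ.V} {L : List Γ.Dart} (h : Γ.IsPath u L v) :
    L.map Γ.start ++ [v] = u :: L.map Γ.finish := by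
  induction L generalizing u with
  | nil => simp [show u = v from h]
  | cons d L ih => simp [ih h.2, h.1]

/-- On a closed path the list of endpoints is the list of starting points rotated by one. -/
theorem IsPath.map_finish_perm {v : Γ.V} {L : List Γ.Dart} (h : Γ.IsPath v L v) :
    (L.map Γ.finish).Perm (L.map Γ.start) := by
  have h1 : (v :: L.map Γ.finish).Perm (v :: L.map Γ.start) := by
    rw [← h.map_start]
    exact List.perm_append_singleton _ _
  exact h1.cons_inv

theorem IsPath.base_mem {v : Γ.V} {L : List Γ.Dart} (h : Γ.IsPath v L v) (hL : L ≠ []) :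
    v ∈ L.map Γ.start := by
  cases L with
  | nil => exact absurd rfl hL
  | cons d L => simp [h.1]

/-- An edge which is passed exactly once by a closed path is not separating. -/
theorem not_isSeparating_of_mem {v : Γ.V} {L : List Γ.Dart} (h : Γ.IsPath v L v)
    (hnd : (L.map Prod.fst).Nodup) {e : Γ.E} (he : e ∈ L.map Prod.fst) : ¬ Γ.IsSeparating e := by
  obtain ⟨d, hd, rfl⟩ := List.mem_map.mp he
  obtain ⟨A, B, rfl⟩ := List.append_of_mem hd
  obtain ⟨w, hA, hB⟩ := h.of_append
  obtain ⟨rfl, hB⟩ := hB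
  have hBA := hB.append hA
  have hne : ∀ d' ∈ B ++ A, d'.1 ≠ d.1 := by
    intro d' hd' heq
    rw [List.map_append, List.map_cons, List.nodup_append] at hnd
    obtain ⟨_, h2, h3⟩ := hnd
    rcases List.mem_append.mp hd' with h | h
    · exact (List.nodup_cons.mp h2).1 (heq ▸ List.mem_map_of_mem h)
    · exact h3 _ (List.mem_map_of_mem h) _ List.mem_cons_self heq
  intro hsep
  apply hsep
  obtain ⟨e, b⟩ := d
  cases b
  · exact ⟨B ++ A, hBA, hne⟩
  · refine ⟨_, hBA.invRev, fun d' hd' => ?_⟩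
    rw [FreeGroup.invRev, List.mem_reverse, List.mem_map] at hd'
    obtain ⟨d'', h, rfl⟩ := hd'
    exact hne d'' h

theorem valence_eq_card_darts [DecidableEq Γ.V] (v : Γ.V) :
    Γ.valence v = (Finset.univ.filter fun d : Γ.Dart => Γ.start d = v).card := by
  classical
  rw [Finset.card_filter, Fintype.sum_prod_type, valence, Set.ncard_eq_toFinset_card',
    Set.ncard_eq_toFinset_card', Set.toFinset_ofPred, Set.toFinset_ofPred, Finset.card_filter,
    Finset.card_filter, ← Finset.sum_add_distrib]
  refine Finset.sum_congr rfl fun e _ => ?_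
  rw [Fintype.sum_bool]
  rfl

theorem sum_valence : ∑ v, Γ.valence v = 2 * Fintype.card Γ.E := by
  classical
  simp_rw [valence_eq_card_darts]
  rw [← Finset.card_eq_sum_card_fiberwise (f := Γ.start) (t := Finset.univ) (by simp)]
  simp [mul_comm]

theorem card_le_valence (v : Γ.V) (S : Finset Γ.Dart) (h : ∀ d ∈ S, Γ.start d = v) :
    S.card ≤ Γ.valence v := by
  classical
  rw [valence_eq_card_darts]
  exact Finset.card_le_card fun d hd => by simpa using h d hd

theorem three_le_valence_of_darts {v : Γ.V} (d₁ d₂ d₃ : Γ.Dart) (h₁ : Γ.start d₁ = v)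
    (h₂ : Γ.start d₂ = v) (h₃ : Γ.start d₃ = v) (h₁₂ : d₁ ≠ d₂) (h₁₃ : d₁ ≠ d₃)
    (h₂₃ : d₂ ≠ d₃) : 3 ≤ Γ.valence v := by
  classical
  rw [← Finset.card_eq_three.mpr ⟨d₁, d₂, d₃, h₁₂, h₁₃, h₂₃, rfl⟩]
  apply card_le_valence
  simp [h₁, h₂, h₃]

end FinGraph

/-! ### Spanning trees and the construction of markings. -/

/-- A rooted spanning tree of a graph, described by the last oriented edge `parent v` of the tree
path from the root to each vertex `v` other than the root. -/
structure SpanningTree (Γ : FinGraph) where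
  root : Γ.V
  parent : Γ.V → Γ.Dart
  height : Γ.V → ℕ
  finish_parent : ∀ v, v ≠ root → Γ.finish (parent v) = v
  height_lt : ∀ v, v ≠ root → height (Γ.start (parent v)) < height v

namespace SpanningTree

open FinGraph

variable {Γ : FinGraph} (T : SpanningTree Γ)

/-- The edges of the tree. -/
def IsTreeEdge (e : Γ.E) : Prop := ∃ v, v ≠ T.root ∧ (T.parent v).1 = e

open Classical in
/-- The tree path from the root to `v`. -/
noncomputable def path {Γ : FinGraph} (T : SpanningTree Γ) (v : Γ.V) : List Γ.Dart :=
  if _h : v = T.root then [] else path T (Γ.start (T.parent v)) ++ [T.parent v]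
termination_by T.height v
decreasing_by exact T.height_lt v _h

theorem path_root : T.path T.root = [] := by
  rw [path, dif_pos rfl]

theorem path_of_ne {v : Γ.V} (h : v ≠ T.root) :
    T.path v = T.path (Γ.start (T.parent v)) ++ [T.parent v] := by
  rw [path, dif_neg h]

theorem isPath_path (v : Γ.V) : Γ.IsPath T.root (T.path v) v := by
  induction hm : T.height v using Nat.strong_induction_on generalizing v with
  | _ m ih =>
    by_cases h : v = T.root
    · subst h
      rw [path_root]
      rfl
    · rw [path_of_ne T h]
      have h1 := ih _ (hm ▸ T.height_lt v h) _ rfl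
      have h2 := isPath_singleton (T.parent v)
      rw [T.finish_parent v h] at h2
      exact h1.append h2

theorem connected {Γ : FinGraph} (T : SpanningTree Γ) : Γ.Connected :=
  ⟨⟨T.root⟩, fun u v => ⟨_, (T.isPath_path u).invRev.append (T.isPath_path v)⟩⟩

theorem isTreeEdge_of_mem_path {v : Γ.V} : ∀ d ∈ T.path v, T.IsTreeEdge d.1 := by
  induction hm : T.height v using Nat.strong_induction_on generalizing v with
  | _ m ih =>
    intro d hd
    by_cases h : v = T.root
    · subst h
      rw [path_root] at hd
      simp at hd
    · rw [path_of_ne T h, List.mem_append, List.mem_singleton] at hd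
      rcases hd with hd | rfl
      · exact ih _ (hm ▸ T.height_lt v h) rfl d hd
      · exact ⟨v, h, rfl⟩

/-- If `v` and `w` had the same parent edge with opposite directions, each would be the parent
vertex of the other, and each height would be smaller than the other. -/
theorem parent_fst_injOn {v w : Γ.V} (hv : v ≠ T.root) (hw : w ≠ T.root)
    (h : (T.parent v).1 = (T.parent w).1) : v = w := by
  rcases eq_or_eq_rev h with h1 | h1
  · rw [← T.finish_parent v hv, ← T.finish_parent w hw, h1]
  · have h2 := T.height_lt w hw
    have h3 := T.height_lt v hv
    have h4 := T.finish_parent v hv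
    have h5 := T.finish_parent w hw
    rw [h1, start_rev, h4] at h2
    rw [h1, finish_rev] at h5
    rw [h5] at h3
    omega

open Classical in
theorem card_isTreeEdge :
    (Finset.univ.filter fun e => T.IsTreeEdge e).card + 1 = Fintype.card Γ.V := by
  have h : (Finset.univ.filter fun e => T.IsTreeEdge e) =
      (Finset.univ.erase T.root).image fun v => (T.parent v).1 := by
    ext e
    simp only [Finset.mem_filter, Finset.mem_univ, true_and, Finset.mem_image, Finset.mem_erase,
      and_true]
    rfl
  rw [h, Finset.card_image_of_injOn, Finset.card_erase_of_mem (Finset.mem_univ _),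
    Finset.card_univ]
  · have : 0 < Fintype.card Γ.V := Fintype.card_pos_iff.mpr ⟨T.root⟩
    omega
  · intro v hv w hw hvw
    exact T.parent_fst_injOn (by simpa using hv) (by simpa using hw) hvw

/-- The retraction of the groupoid of edge paths onto the fundamental group at the root. -/
noncomputable def retract : FreeGroup Γ.E →* FreeGroup Γ.E :=
  FreeGroup.lift fun e => FreeGroup.mk (T.path (Γ.src e)) * FreeGroup.of e *
    (FreeGroup.mk (T.path (Γ.tgt e)))⁻¹

theorem retract_dart (d : Γ.Dart) : T.retract (FreeGroup.mk [d]) =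
    FreeGroup.mk (T.path (Γ.start d)) * FreeGroup.mk [d] *
      (FreeGroup.mk (T.path (Γ.finish d)))⁻¹ := by
  obtain ⟨e, b⟩ := d
  cases b
  · have h : (FreeGroup.mk [(e, false)] : FreeGroup Γ.E) = (FreeGroup.of e)⁻¹ := rfl
    rw [h, map_inv, retract, FreeGroup.lift_apply_of]
    simp [start, finish, mul_assoc]
  · have h : (FreeGroup.mk [(e, true)] : FreeGroup Γ.E) = FreeGroup.of e := rfl
    rw [h, retract, FreeGroup.lift_apply_of]
    simp [start, finish]

/-- The product telescopes: the tree paths to the intermediate vertices cancel. -/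
theorem retract_isPath {u v : Γ.V} {L : List Γ.Dart} (h : Γ.IsPath u L v) :
    T.retract (FreeGroup.mk L) =
      FreeGroup.mk (T.path u) * FreeGroup.mk L * (FreeGroup.mk (T.path v))⁻¹ := by
  induction L generalizing u with
  | nil =>
    obtain rfl : u = v := h
    rw [← FreeGroup.one_eq_mk, mul_one, mul_inv_cancel, map_one]
  | cons d L ih =>
    have h1 : (FreeGroup.mk (d :: L) : FreeGroup Γ.E) = FreeGroup.mk [d] * FreeGroup.mk L := by
      rw [FreeGroup.mul_mk]
      rfl
    rw [h1, map_mul, ih h.2, retract_dart, h.1]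
    group

theorem retract_eq_self {x : FreeGroup Γ.E} (hx : x ∈ Γ.pi1 T.root) : T.retract x = x := by
  obtain ⟨L, hL, rfl⟩ := hx
  rw [T.retract_isPath hL, path_root, ← FreeGroup.one_eq_mk, one_mul, inv_one, mul_one]

theorem retract_of_isTreeEdge {e : Γ.E} (he : T.IsTreeEdge e) :
    T.retract (FreeGroup.of e) = 1 := by
  obtain ⟨v, hv, rfl⟩ := he
  have h1 : T.retract (FreeGroup.mk [T.parent v]) = 1 := by
    rw [retract_dart, T.finish_parent v hv, T.path_of_ne hv, ← FreeGroup.mul_mk, mul_inv_cancel]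
  rcases hd : T.parent v with ⟨e, b⟩
  rw [hd] at h1
  cases b
  · have h : (FreeGroup.mk [(e, false)] : FreeGroup Γ.E) = (FreeGroup.of e)⁻¹ := rfl
    rw [h, map_inv, inv_eq_one] at h1
    exact h1
  · exact h1

theorem map_mk_eq_one_of_isTreeEdge {H : Type*} [Group H] (f : FreeGroup Γ.E →* H)
    (hf : ∀ e, T.IsTreeEdge e → f (FreeGroup.of e) = 1) {L : List Γ.Dart}
    (hL : ∀ d ∈ L, T.IsTreeEdge d.1) : f (FreeGroup.mk L) = 1 := by
  induction L with
  | nil => exact map_one f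
  | cons d L ih =>
    have h1 : (FreeGroup.mk (d :: L) : FreeGroup Γ.E) = FreeGroup.mk [d] * FreeGroup.mk L := by
      rw [FreeGroup.mul_mk]
      rfl
    have h2 := hf _ (hL d (by simp))
    have h3 : f (FreeGroup.mk [d]) = 1 := by
      rcases d with ⟨e, b⟩
      cases b
      · have h : (FreeGroup.mk [(e, false)] : FreeGroup Γ.E) = (FreeGroup.of e)⁻¹ := rfl
        rw [h, map_inv, inv_eq_one]
        exact h2
      · exact h2
    rw [h1, map_mul, h3, ih fun d' hd' => hL d' (by simp [hd']), one_mul]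

theorem retract_mem_pi1 (x : FreeGroup Γ.E) : T.retract x ∈ Γ.pi1 T.root := by
  have h : T.retract.range ≤ Γ.pi1 T.root := by
    refine FreeGroup.range_lift_le ?_
    rintro _ ⟨e, rfl⟩
    refine ⟨T.path (Γ.src e) ++ [(e, true)] ++ FreeGroup.invRev (T.path (Γ.tgt e)),
      ((T.isPath_path _).append (isPath_singleton (e, true))).append (T.isPath_path _).invRev, ?_⟩
    rw [← FreeGroup.mul_mk, ← FreeGroup.mul_mk, ← FreeGroup.inv_mk]
    rfl
  exact h ⟨x, rfl⟩

open Classical in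
/-- A relative graph with a spanning tree which misses exactly one edge of each petal can be
marked. -/
theorem exists_marking {n k : ℕ} {s : Fin k → ℕ} (G : RelGraph n s)
    (T : SpanningTree G.toFinGraph)
    (hT : ∀ j i, ∃ A e, G.petal j i = A ++ [(e, true)] ∧ (∀ d ∈ A, T.IsTreeEdge d.1) ∧
      ¬ T.IsTreeEdge e) :
    ∃ M : MarkedGraph n s, M.toRelGraph = G := by
  choose A ε hpetal hA hε using hT
  -- The number of edges outside a spanning tree is the rank.
  have hcard : Fintype.card {e // ¬ T.IsTreeEdge e} = n := by
    have h1 := T.card_isTreeEdge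
    have h2 := G.rank_eq
    have h3 := Fintype.card_subtype_compl (fun e => T.IsTreeEdge e)
    have h4 := Fintype.card_subtype_le (fun e => T.IsTreeEdge e)
    rw [Fintype.card_subtype] at h4
    rw [h3, Fintype.card_subtype]
    omega
  let ι : (Σ j : Fin k, Fin (s j)) → {e // ¬ T.IsTreeEdge e} := fun p => ⟨ε p.1 p.2, hε p.1 p.2⟩
  have hmem : ∀ j i, ε j i ∈ (G.petal j i).map Prod.fst := fun j i => by simp [hpetal j i]
  have hι : Function.Injective ι := by
    rintro ⟨j, i⟩ ⟨j', i'⟩ h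
    have h1 : ε j i = ε j' i' := congrArg Subtype.val h
    have h2 := hmem j i
    have h3 := hmem j' i'
    rw [← h1] at h3
    by_cases hj : j = j'
    · subst hj
      by_cases hi : i = i'
      · rw [hi]
      · exact (G.petal_edges_disjoint j i i' hi h2 h3).elim
    · exact (G.wedge_edges_disjoint j j' hj i i' h2 h3).elim
  have hcompl : Fintype.card {e // e ∉ Set.range ι} = n - ∑ j, s j := by
    have h1 := Fintype.card_subtype_compl (fun e => e ∈ Set.range ι)
    have h2 : Fintype.card {e // e ∈ Set.range ι} = ∑ j, s j := by
      rw [← Fintype.card_congr (Equiv.ofInjective ι hι)]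
      simp
    rw [h2, hcard] at h1
    exact h1
  let κ := (Fintype.equivFinOfCardEq hcompl).symm
  let β : Gen n s → {e // ¬ T.IsTreeEdge e} := Sum.elim ι fun i => (κ i).1
  have hβ : Function.Bijective β := by
    refine ⟨Function.Injective.sumElim hι (Subtype.val_injective.comp κ.injective) ?_, ?_⟩
    · intro a b h
      exact (κ b).2 ⟨a, h⟩
    · intro e
      by_cases he : e ∈ Set.range ι
      · obtain ⟨p, rfl⟩ := he
        exact ⟨Sum.inl p, rfl⟩
      · exact ⟨Sum.inr (κ.symm ⟨e, he⟩), by simp [β]⟩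
  -- The basis of `F_n` now corresponds to the non-tree edges, with each `y_i^j` going to the last
  -- edge of its petal.
  let b := Equiv.ofBijective β hβ
  let stem : Fin k → List G.Dart := fun j => T.path (G.base j)
  let loop : Fin (n - ∑ j, s j) → List G.Dart := fun i =>
    T.path (G.src (κ i).1.1) ++ [((κ i).1.1, true)] ++ FreeGroup.invRev (T.path (G.tgt (κ i).1.1))
  -- All other edges of a petal are in the tree and are killed by the retraction, so stem, petal and
  -- reversed stem together represent the loop of the last edge.
  have hmark : ∀ x, G.mark stem loop x = T.retract (FreeGroup.of (b x).1) := by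
    rintro (⟨j, i⟩ | i)
    · have h1 := T.retract_isPath (G.petal_isPath j i)
      have h2 : T.retract (FreeGroup.mk (G.petal j i)) = T.retract (FreeGroup.of (ε j i)) := by
        rw [hpetal, ← FreeGroup.mul_mk, map_mul,
          T.map_mk_eq_one_of_isTreeEdge T.retract (fun e => T.retract_of_isTreeEdge) (hA j i),
          one_mul]
        rfl
      change FreeGroup.mk (stem j) * FreeGroup.mk (G.petal j i) * (FreeGroup.mk (stem j))⁻¹ = _
      rw [← h1, h2]
      rfl
    · change FreeGroup.mk (loop i) = T.retract (FreeGroup.of (κ i).1.1)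
      rw [retract, FreeGroup.lift_apply_of, ← FreeGroup.mul_mk, ← FreeGroup.mul_mk,
        ← FreeGroup.inv_mk]
      rfl
  -- Collapsing the tree gives a left inverse of the marking, hence injectivity.
  let σ : FreeGroup G.E →* FreeGroup (Gen n s) := FreeGroup.lift fun e =>
    if h : T.IsTreeEdge e then 1 else FreeGroup.of (b.symm ⟨e, h⟩)
  have hσ : ∀ e, T.IsTreeEdge e → σ (FreeGroup.of e) = 1 := fun e h => by
    simp only [σ, FreeGroup.lift_apply_of, dif_pos h]
  have hσ' : ∀ x, σ (G.mark stem loop x) = FreeGroup.of x := fun x => by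
    rw [hmark, retract, FreeGroup.lift_apply_of, map_mul, map_mul, map_inv,
      T.map_mk_eq_one_of_isTreeEdge σ hσ (T.isTreeEdge_of_mem_path),
      T.map_mk_eq_one_of_isTreeEdge σ hσ (T.isTreeEdge_of_mem_path)]
    simp only [σ, FreeGroup.lift_apply_of, dif_neg (b x).2]
    simp
  refine ⟨{ G with
    center := T.root
    stem := stem
    stem_isPath := fun j => T.isPath_path _
    loop := loop
    loop_isPath := fun i =>
      ((T.isPath_path _).append (isPath_singleton (_, true))).append (T.isPath_path _).invRev
    mark_injective := ?_
    mark_range := ?_ }, rfl⟩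
  · have h : σ.comp (FreeGroup.lift (G.mark stem loop)) = MonoidHom.id _ := by
      ext x
      simp [hσ']
    exact Function.LeftInverse.injective (g := σ) fun x => DFunLike.congr_fun h x
  · apply le_antisymm
    · refine FreeGroup.range_lift_le ?_
      rintro _ ⟨x, rfl⟩
      rw [hmark]
      exact T.retract_mem_pi1 _
    · intro x hx
      rw [← T.retract_eq_self hx]
      -- The retraction is the identity on `pi1`, so surjectivity need only be checked on the images
      -- of single edges.
      have h : T.retract.range ≤ (FreeGroup.lift (G.mark stem loop)).range := by
        refine FreeGroup.range_lift_le ?_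
        rintro _ ⟨e, rfl⟩
        have h1 : T.retract (FreeGroup.of e) ∈ (FreeGroup.lift (G.mark stem loop)).range := by
          by_cases he : T.IsTreeEdge e
          · rw [T.retract_of_isTreeEdge he]
            exact one_mem _
          · refine ⟨FreeGroup.of (b.symm ⟨e, he⟩), ?_⟩
            rw [FreeGroup.lift_apply_of, hmark]
            simp
        rwa [retract, FreeGroup.lift_apply_of] at h1
      exact h ⟨x, rfl⟩

end SpanningTree

/-! ### Petals as blocks, and the bound from valences. -/

open FinGraph

namespace RelGraph

variable {n k : ℕ} {s : Fin k → ℕ} (G : RelGraph n s)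

/-- The vertex `v` lies on the `j`-th wedge. -/
def OnWedge (j : Fin k) (v : G.V) : Prop := ∃ i, v ∈ (G.petal j i).map G.start

theorem petal_unique {e : G.E} {p p' : Σ j : Fin k, Fin (s j)}
    (h : e ∈ (G.petal p.1 p.2).map Prod.fst) (h' : e ∈ (G.petal p'.1 p'.2).map Prod.fst) :
    p = p' := by
  obtain ⟨j, i⟩ := p
  obtain ⟨j', i'⟩ := p'
  by_cases hj : j = j'
  · subst hj
    by_cases hi : i = i'
    · rw [hi]
    · exact (G.petal_edges_disjoint j i i' hi h h').elim
  · exact (G.wedge_edges_disjoint j j' hj i i' h h').elim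

open Classical in
/-- The petal which contains a given edge, if there is one. -/
noncomputable def block (e : G.E) : Option (Σ j : Fin k, Fin (s j)) :=
  if h : ∃ p : Σ j : Fin k, Fin (s j), e ∈ (G.petal p.1 p.2).map Prod.fst then some h.choose
  else none

theorem block_eq_some_iff {e : G.E} {p : Σ j : Fin k, Fin (s j)} :
    G.block e = some p ↔ e ∈ (G.petal p.1 p.2).map Prod.fst := by
  unfold block
  split_ifs with h
  · rw [Option.some_inj]
    exact ⟨fun h' => h' ▸ h.choose_spec, fun h' => G.petal_unique h.choose_spec h'⟩
  · exact ⟨fun h' => by simp at h', fun h' => (h ⟨p, h'⟩).elim⟩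

theorem block_eq_none_iff {e : G.E} :
    G.block e = none ↔ ∀ j i, e ∉ (G.petal j i).map Prod.fst := by
  rw [Option.eq_none_iff_forall_ne_some]
  refine ⟨fun h j i he => h ⟨j, i⟩ (G.block_eq_some_iff.mpr he), fun h p hp => ?_⟩
  exact h _ _ (G.block_eq_some_iff.mp hp)

theorem exists_block_eq (p : Σ j : Fin k, Fin (s j)) : ∃ e, G.block e = some p := by
  obtain ⟨d, hd⟩ := List.exists_mem_of_ne_nil _ (G.petal_ne_nil p.1 p.2)
  exact ⟨d.1, G.block_eq_some_iff.mpr (List.mem_map_of_mem hd)⟩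

open Classical in
theorem sum_petal (l : G.E → ℝ) (p : Σ j : Fin k, Fin (s j)) :
    ((G.petal p.1 p.2).map fun d => l d.1).sum = ∑ e with G.block e = some p, l e := by
  have h1 : (G.petal p.1 p.2).map (fun d => l d.1) =
      ((G.petal p.1 p.2).map Prod.fst).map l := by
    rw [List.map_map]
    rfl
  rw [h1, ← List.sum_toFinset l (G.petal_edges_nodup p.1 p.2)]
  congr 1
  ext e
  rw [List.mem_toFinset, Finset.mem_filter, block_eq_some_iff]
  simp

theorem base_onWedge (hs : ∀ j, 1 ≤ s j) (j : Fin k) : G.OnWedge j (G.base j) :=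
  ⟨⟨0, hs j⟩, (G.petal_isPath j _).base_mem (G.petal_ne_nil j _)⟩

open Classical in
/-- The petals contribute two half edges each to the valence of their basepoint. -/
theorem sum_le_valence (v : G.V) : ∑ j with G.base j = v, 2 * s j ≤ G.valence v := by
  let P := Σ j : {j : Fin k // G.base j = v}, Fin (s j.1)
  -- Each petal leaves its basepoint by its first oriented edge and, read backwards, by its reversed
  -- last one.
  let f : P × Bool → G.Dart := fun q => if q.2 then
    (G.petal q.1.1 q.1.2).head (G.petal_ne_nil _ _) else
    rev ((G.petal q.1.1 q.1.2).getLast (G.petal_ne_nil _ _))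
  have hf1 : ∀ q, (f q).1 ∈ (G.petal q.1.1 q.1.2).map Prod.fst := by
    rintro ⟨q, b⟩
    cases b
    · have h := List.mem_map_of_mem (f := Prod.fst) (List.getLast_mem (G.petal_ne_nil q.1 q.2))
      exact h
    · have h := List.mem_map_of_mem (f := Prod.fst) (List.head_mem (G.petal_ne_nil q.1 q.2))
      exact h
  have hf2 : ∀ q, G.start (f q) = v := by
    rintro ⟨⟨⟨j, hj⟩, i⟩, b⟩
    have h := G.petal_isPath j i
    cases b
    · change G.start (rev ((G.petal j i).getLast (G.petal_ne_nil _ _))) = v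
      rw [← List.dropLast_append_getLast (G.petal_ne_nil j i)] at h
      obtain ⟨w, -, -, h1⟩ := h.of_append
      rw [start_rev, ← hj]
      exact h1
    · change G.start ((G.petal j i).head (G.petal_ne_nil _ _)) = v
      obtain ⟨d, L, hL⟩ := List.exists_cons_of_ne_nil (G.petal_ne_nil j i)
      simp only [hL] at h ⊢
      rw [List.head_cons, h.1, hj]
  have hf : Function.Injective f := by
    rintro ⟨⟨⟨j, hj⟩, i⟩, b⟩ ⟨⟨⟨j', hj'⟩, i'⟩, b'⟩ h
    have h1 := hf1 ⟨⟨⟨j, hj⟩, i⟩, b⟩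
    have h2 := hf1 ⟨⟨⟨j', hj'⟩, i'⟩, b'⟩
    rw [← h] at h2
    have h3 := G.petal_unique (p := ⟨j, i⟩) (p' := ⟨j', i'⟩) h1 h2
    obtain ⟨rfl, h4⟩ := Sigma.mk.inj_iff.mp h3
    obtain rfl := eq_of_heq h4
    -- If the two edges coincide, the petal is a loop traversed in one direction, and its two half
    -- edges still differ.
    have key : (G.petal j i).head (G.petal_ne_nil _ _) ≠
        rev ((G.petal j i).getLast (G.petal_ne_nil _ _)) := by
      intro h5
      have h7 : ((G.petal j i).head (G.petal_ne_nil _ _)).1 =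
        ((G.petal j i).getLast (G.petal_ne_nil _ _)).1 := by
        have h8 := congrArg Prod.fst h5
        exact h8
      have h6 := List.inj_on_of_nodup_map (G.petal_edges_nodup j i)
        (List.head_mem (G.petal_ne_nil j i)) (List.getLast_mem (G.petal_ne_nil j i))
        h7
      rw [h6] at h5
      exact rev_ne _ h5.symm
    cases b <;> cases b'
    · rfl
    · exact (key h.symm).elim
    · exact (key h).elim
    · rfl
  calc ∑ j with G.base j = v, 2 * s j = Fintype.card (P × Bool) := by
        rw [Fintype.card_prod, Fintype.card_sigma, Fintype.card_bool, Finset.sum_mul,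
          Finset.sum_subtype (p := fun j => G.base j = v) _ (by simp)]
        exact Finset.sum_congr rfl fun j _ => by rw [Fintype.card_fin, mul_comm]
    _ = (Finset.univ.map ⟨f, hf⟩).card := by rw [Finset.card_map, Finset.card_univ]
    _ ≤ G.valence v := by
        refine card_le_valence _ _ fun d hd => ?_
        obtain ⟨q, -, rfl⟩ := Finset.mem_map.mp hd
        exact hf2 q

/-- Sum the local bound `h1` over all vertices and use `2E = ∑ valence` and `V = E + 1 - n`. The
natural subtraction matters: `2 * s j - 3` is `0` when `s j = 1`, and this is the origin of the term
`m`. -/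
theorem card_edges_le (hs : ∀ j, 1 ≤ s j) :
    Fintype.card G.E + 2 * ∑ j, s j + (Finset.univ.filter fun j => s j = 1).card + 3 ≤
      3 * n + 3 * k := by
  classical
  have h1 : ∀ v, 3 + ∑ j with G.base j = v, (2 * s j - 3) ≤ G.valence v := by
    intro v
    have h2 := G.sum_le_valence v
    by_cases h : ∃ j, G.base j = v ∧ 2 ≤ s j
    · obtain ⟨j, hj, hsj⟩ := h
      refine le_trans ?_ h2
      have hmem : j ∈ Finset.univ.filter fun j => G.base j = v := by simpa using hj
      -- One wedge with `s j ≥ 2` absorbs the summand 3, as `2 s j = 3 + (2 s j - 3)`; the other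
      -- wedges based here have room to spare.
      rw [← Finset.add_sum_erase _ _ hmem, ← Finset.add_sum_erase _ _ hmem, ← add_assoc]
      exact add_le_add (by omega) (Finset.sum_le_sum fun i _ => by omega)
    · push Not at h
      rw [Finset.sum_eq_zero]
      · exact G.three_le_valence v
      · intro j hj
        have := h j (by simpa using hj)
        omega
  have h2 : ∑ v, (3 + ∑ j with G.base j = v, (2 * s j - 3)) ≤ 2 * Fintype.card G.E := by
    rw [← sum_valence]
    exact Finset.sum_le_sum fun v _ => h1 v
  have h6 : ∑ v, ∑ j with G.base j = v, (2 * s j - 3) = ∑ j, (2 * s j - 3) := by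
    convert! Finset.sum_fiberwise Finset.univ G.base (fun j => 2 * s j - 3)
  rw [Finset.sum_add_distrib, Finset.sum_const, Finset.card_univ, smul_eq_mul,
    h6] at h2
  have h3 : ∑ j, (2 * s j - 3) + 3 * k =
      2 * ∑ j, s j + (Finset.univ.filter fun j => s j = 1).card := by
    have h4 : 3 * k = ∑ _j : Fin k, 3 := by simp [mul_comm]
    rw [h4, ← Finset.sum_add_distrib, Finset.card_filter, Finset.mul_sum,
      ← Finset.sum_add_distrib]
    refine Finset.sum_congr rfl fun j _ => ?_
    have := hs j
    split_ifs <;> omega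
  have h5 := G.rank_eq
  omega

end RelGraph

namespace MarkedGraph

variable {n k : ℕ} {s : Fin k → ℕ} (G : MarkedGraph n s)

-- Indexing by the range of `block` absorbs the case distinction for the relative volume: `none` is
-- attained exactly when some edge is outside, while every petal is attained.
open Classical in
theorem polysimplex_eq : G.polysimplex = {l | (∀ e, 0 < l e) ∧
    ∀ b : Set.range G.block, ∑ e with Set.rangeFactorization G.block e = b, l e = 1} := by
  ext l
  have h : ∀ e (b : Set.range G.block),
      Set.rangeFactorization G.block e = b ↔ G.block e = b.1 := fun e b => Subtype.ext_iff
  simp only [polysimplex, Set.mem_ofPred_eq, h]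
  have h2 : ∀ e, e ∈ G.outside ↔ G.block e = none := fun e => G.block_eq_none_iff.symm
  simp only [h2]
  refine and_congr_right fun _ => ⟨?_, fun H => ⟨fun j i => ?_, ?_⟩⟩
  · rintro ⟨h3, h4⟩ ⟨b, e, rfl⟩
    change ∑ x with G.block x = G.block e, l x = 1
    generalize hb : G.block e = b
    rcases b with _ | p
    · exact h4 ⟨e, (h2 e).mpr hb⟩
    · rw [← G.sum_petal l p]
      exact h3 _ _
  · obtain ⟨e, he⟩ := G.exists_block_eq ⟨j, i⟩
    have := H ⟨_, e, he⟩
    rwa [← G.sum_petal l] at this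
  · rintro ⟨e, he⟩
    exact H ⟨none, e, (h2 e).mp he⟩

theorem polysimplex_nonempty : G.polysimplex.Nonempty := by
  classical
  obtain ⟨l, hl⟩ := exists_blocks_pos (Set.rangeFactorization G.block)
    Set.rangeFactorization_surjective
  exact ⟨l, by rw [polysimplex_eq]; exact hl⟩

theorem polysimplexDim_add_card_range : G.polysimplexDim + Nat.card (Set.range G.block) =
    Fintype.card G.E := by
  classical
  have h := finrank_vectorSpan_blocks (Set.rangeFactorization G.block)
    Set.rangeFactorization_surjective
  rw [← Nat.card_eq_fintype_card (α := Set.range G.block)] at h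
  rw [← h, polysimplexDim, polysimplex_eq]

theorem polysimplexDim_of_outside_nonempty (h : G.outside.Nonempty) :
    G.polysimplexDim + (∑ j, s j + 1) = Fintype.card G.E := by
  rw [← polysimplexDim_add_card_range]
  have h1 : Set.range G.block = Set.univ := by
    refine Set.range_eq_univ.mpr fun b => ?_
    rcases b with _ | p
    · obtain ⟨e, he⟩ := h
      exact ⟨e, G.block_eq_none_iff.mpr he⟩
    · exact G.exists_block_eq p
  rw [h1, Nat.card_congr (Equiv.Set.univ _)]
  simp

theorem polysimplexDim_of_outside_eq_empty (h : G.outside = ∅) :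
    G.polysimplexDim + ∑ j, s j = Fintype.card G.E := by
  rw [← polysimplexDim_add_card_range]
  have h1 : Set.range G.block = Set.range some := by
    ext b
    rcases b with _ | p
    · simp only [Set.mem_range, reduceCtorEq, exists_false, iff_false, not_exists]
      intro e he
      have : e ∈ G.outside := G.block_eq_none_iff.mp he
      simp [h] at this
    · simpa using G.exists_block_eq p
  rw [h1, Nat.card_range_of_injective (Option.some_injective _)]
  simp

end MarkedGraph

/-! ### The reduced part and reduction of `dim` to marked graphs. -/

theorem isSeparating_of_iso {Γ Δ : FinGraph} (hV : Γ.V ≃ Δ.V) (hE : Γ.E ≃ Δ.E)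
    (flip : Γ.E → Bool)
    (h : ∀ e, Δ.start (hE e, !flip e) = hV (Γ.src e) ∧ Δ.finish (hE e, !flip e) = hV (Γ.tgt e))
    (e : Γ.E) (hsep : Δ.IsSeparating (hE e)) : Γ.IsSeparating e := by
  rintro ⟨L, hL, hne⟩
  apply hsep
  let φ : Γ.Dart → Δ.Dart := fun d => if d.2 then (hE d.1, !flip d.1) else (hE d.1, flip d.1)
  have hφ : ∀ d, Δ.start (φ d) = hV (Γ.start d) ∧ Δ.finish (φ d) = hV (Γ.finish d) := by
    rintro ⟨e', b⟩
    have h1 := h e'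
    cases b
    · have h2 : φ (e', false) = rev (hE e', !flip e') := by simp [φ, rev]
      rw [h2, start_rev, finish_rev]
      exact ⟨h1.2, h1.1⟩
    · exact h1
  have hφ1 : ∀ d, (φ d).1 = hE d.1 := fun d => by simp only [φ]; split_ifs <;> rfl
  have hmap : ∀ (L : List Γ.Dart) u v, Γ.IsPath u L v → Δ.IsPath (hV u) (L.map φ) (hV v) := by
    intro L
    induction L with
    | nil => exact fun u v h => congrArg hV h
    | cons d L ih =>
      rintro u v ⟨h1, h2⟩
      refine ⟨(hφ d).1.trans (congrArg hV h1), ?_⟩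
      rw [(hφ d).2]
      exact ih _ _ h2
  have h1 := hmap L _ _ hL
  have h2 : ∀ d ∈ L.map φ, d.1 ≠ hE e := by
    intro d hd
    obtain ⟨d', hd', rfl⟩ := List.mem_map.mp hd
    rw [hφ1]
    exact fun h => hne d' hd' (hE.injective h)
  rw [← (h e).1, ← (h e).2] at h1
  cases hf : flip e
  · exact ⟨L.map φ, by simpa [hf, start, finish] using h1, h2⟩
  · refine ⟨FreeGroup.invRev (L.map φ), by simpa [hf, start, finish] using h1.invRev, ?_⟩
    intro d hd
    rw [FreeGroup.invRev, List.mem_reverse, List.mem_map] at hd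
    obtain ⟨d', hd', rfl⟩ := hd
    exact h2 d' hd'

namespace MarkedMetricGraph

variable {n k : ℕ} {s : Fin k → ℕ}

theorem Equivalent.noSeparatingEdges_iff {G H : MarkedMetricGraph n s} (h : G.Equivalent H) :
    (∀ e, ¬ G.IsSeparating e) ↔ ∀ e, ¬ H.IsSeparating e := by
  obtain ⟨hV, hE, flip, h1, -⟩ := h
  constructor
  · intro H1 e he
    obtain ⟨e, rfl⟩ := hE.surjective e
    exact H1 e (isSeparating_of_iso hV hE flip h1 e he)
  · intro H1 e he
    refine H1 (hE e) (isSeparating_of_iso hV.symm hE.symm (fun e => flip (hE.symm e)) ?_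
      (hE e) (by simpa using he))
    intro e'
    obtain ⟨e', rfl⟩ := hE.surjective e'
    have h2 := h1 e'
    rw [Equiv.symm_apply_apply, Equiv.eq_symm_apply, Equiv.eq_symm_apply]
    cases hf : flip e' <;> simp [hf, start, finish] at h2 ⊢ <;> simp [h2]

end MarkedMetricGraph

namespace RelOuterSpace

variable {n k : ℕ} {s : Fin k → ℕ}

/-- Membership only provides some representative without separating edges; the property descends to
the quotient because it is invariant under equivalence. -/
theorem mk_mem_reduced_iff (G : MarkedMetricGraph n s) :
    (Quot.mk _ G : RelOuterSpace n s) ∈ reduced n s ↔ ∀ e, ¬ G.IsSeparating e := by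
  refine ⟨?_, fun h => ⟨G, h, rfl⟩⟩
  rintro ⟨H, hH, heq⟩
  let f : RelOuterSpace n s → Prop := Quot.lift
    (fun G : MarkedMetricGraph n s => ∀ e, ¬ G.IsSeparating e)
    fun _ _ h => propext h.noSeparatingEdges_iff
  have h : f (Quot.mk _ G) = f (Quot.mk _ H) := congrArg f heq
  exact h.mpr hH

theorem openPolysimplex_subset_reduced_iff (G : MarkedGraph n s) :
    openPolysimplex G ⊆ reduced n s ↔ ∀ e, ¬ G.IsSeparating e := by
  constructor
  · intro h
    -- An empty polysimplex would lie in the reduced part for trivial reasons.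
    obtain ⟨l, hl⟩ := G.polysimplex_nonempty
    exact (mk_mem_reduced_iff ⟨G, l, hl⟩).mp (h ⟨l, hl, rfl⟩)
  · rintro h _ ⟨l, hl, rfl⟩
    exact (mk_mem_reduced_iff _).mpr h

theorem dim_eq {X : Set (RelOuterSpace n s)} (G : MarkedGraph n s) (hG : openPolysimplex G ⊆ X)
    (h : ∀ H : MarkedGraph n s, openPolysimplex H ⊆ X → H.polysimplexDim ≤ G.polysimplexDim) :
    dim X = ((G.polysimplexDim : ℕ∞) : WithBot ℕ∞) := by
  apply le_antisymm
  · refine iSup₂_le fun H hH => ?_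
    exact_mod_cast h H hH
  · exact le_iSup₂_of_le G hG le_rfl

end RelOuterSpace

/-! ### Counting with the dual forest. -/

theorem ncard_edgeSet_lt_of_isAcyclic {V : Type*} [Fintype V] [Nonempty V] {F : SimpleGraph V}
    (hF : F.IsAcyclic) : F.edgeSet.ncard + 1 ≤ Fintype.card V := by
  classical
  obtain ⟨T, h1, -, h3⟩ :=
    SimpleGraph.connected_top.exists_isTree_le_of_le_of_isAcyclic le_top hF
  have h4 : F.edgeSet.ncard ≤ T.edgeSet.ncard :=
    Set.ncard_le_ncard (SimpleGraph.edgeSet_mono h1) (Set.toFinite _)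
  have h5 := h3.card_edgeFinset
  rw [← SimpleGraph.coe_edgeFinset T, Set.ncard_coe_finset] at h4
  omega

namespace RelGraph

variable {n k : ℕ} {s : Fin k → ℕ} (G : RelGraph n s)

/-- The points in which at least two wedges meet. -/
def meeting : Set G.V := {v | ∃ j j', j ≠ j' ∧ G.OnWedge j v ∧ G.OnWedge j' v}

open Classical in
/-- The number of wedges through `v`. -/
noncomputable def wedgeCount (v : G.V) : ℕ := (Finset.univ.filter fun j => G.OnWedge j v).card

-- The left sum counts incidences, i.e. edges of the dual forest, which has `k` wedge vertices and
-- one vertex per meeting point.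
open Classical in
theorem sum_wedgeCount_meeting (hk : 1 ≤ k) :
    ∑ v with v ∈ G.meeting, G.wedgeCount v + 1 ≤
      k + (Finset.univ.filter fun v => v ∈ G.meeting).card := by
  have : Nonempty (Fin k) := ⟨⟨0, hk⟩⟩
  let P := {v : G.V // ∃ j j', j ≠ j' ∧ (∃ i, v ∈ (G.petal j i).map G.start) ∧
    ∃ i, v ∈ (G.petal j' i).map G.start}
  have h1 := ncard_edgeSet_lt_of_isAcyclic G.dual_isAcyclic
  have hP : Fintype.card P = (Finset.univ.filter fun v => v ∈ G.meeting).card :=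
    (Fintype.card_subtype _).trans (congrArg Finset.card (Finset.filter_congr fun _ _ => Iff.rfl))
  rw [Fintype.card_sum, Fintype.card_fin, hP] at h1
  refine le_trans ?_ h1
  rw [add_le_add_iff_right]
  let S := Σ p : P, {j : Fin k // G.OnWedge j p.1}
  have hS : Fintype.card S = ∑ v with v ∈ G.meeting, G.wedgeCount v := by
    rw [Fintype.card_sigma, Finset.sum_subtype (p := fun v => v ∈ G.meeting) _ (by simp)]
    exact Finset.sum_congr rfl fun p _ => Fintype.card_subtype _
  rw [← hS, ← Nat.card_eq_fintype_card]
  let f : S → Sym2 (Fin k ⊕ P) := fun q => s(Sum.inl q.2.1, Sum.inr q.1)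
  have hf : Function.Injective f := by
    rintro ⟨p, j⟩ ⟨p', j'⟩ h
    simp only [f, Sym2.eq_iff, Sum.inl.injEq, Sum.inr.injEq, reduceCtorEq, and_self,
      or_false] at h
    obtain ⟨h1, rfl⟩ := h
    rw [Subtype.ext h1]
  rw [← Nat.card_range_of_injective hf, Nat.card_coe_set_eq]
  refine Set.ncard_le_ncard ?_ (Set.toFinite _)
  rintro _ ⟨⟨p, j, hj⟩, rfl⟩
  rw [SimpleGraph.mem_edgeSet, SimpleGraph.fromRel_adj]
  exact ⟨by simp, Or.inl ⟨j, p, rfl, rfl, hj⟩⟩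

theorem two_le_wedgeCount {v : G.V} (hv : v ∈ G.meeting) : 2 ≤ G.wedgeCount v := by
  obtain ⟨j, j', hne, h1, h2⟩ := hv
  exact Finset.one_lt_card.mpr ⟨j, by simpa using h1, j', by simpa using h2, hne⟩

theorem wedgeCount_le_one {v : G.V} (hv : v ∉ G.meeting) : G.wedgeCount v ≤ 1 := by
  refine Finset.card_le_one.mpr fun j hj j' hj' => ?_
  by_contra hne
  exact hv ⟨j, j', hne, by simpa using hj, by simpa using hj'⟩

-- Each meeting point has at least two incidences, so `2M + 1 ≤ k + M` for the number `M` of meeting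
-- points.
open Classical in
theorem card_meeting_lt (hk : 1 ≤ k) :
    (Finset.univ.filter fun v => v ∈ G.meeting).card + 1 ≤ k := by
  have h1 := G.sum_wedgeCount_meeting hk
  have h2 : (Finset.univ.filter fun v => v ∈ G.meeting).card * 2 ≤
      ∑ v with v ∈ G.meeting, G.wedgeCount v := by
    rw [← smul_eq_mul]
    exact Finset.card_nsmul_le_sum _ _ _ fun v hv => G.two_le_wedgeCount (by simpa using hv)
  omega

theorem sum_wedgeCount_lt (hk : 1 ≤ k) :
    ∑ v, G.wedgeCount v + 1 ≤ k + Fintype.card G.V := by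
  classical
  have h1 := G.sum_wedgeCount_meeting hk
  have h2 : ∑ v with v ∉ G.meeting, G.wedgeCount v ≤
      (Finset.univ.filter fun v => v ∉ G.meeting).card := by
    rw [Finset.card_eq_sum_ones]
    exact Finset.sum_le_sum fun v hv => G.wedgeCount_le_one (by simpa using hv)
  have h3 := Finset.sum_filter_add_sum_filter_not Finset.univ (fun v => v ∈ G.meeting)
    G.wedgeCount
  have h4 := Finset.card_filter_add_card_filter_not (s := Finset.univ) (fun v => v ∈ G.meeting)
  rw [Finset.card_univ] at h4
  omega

-- Euler characteristic of a wedge: a petal of length `L` has `L - 1` vertices besides the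
-- basepoint, and these are disjoint for different petals.
open Classical in
theorem sum_length_petal_lt (hs : ∀ j, 1 ≤ s j) (j : Fin k) :
    ∑ i, (G.petal j i).length + 1 ≤
      s j + (Finset.univ.filter fun v => G.OnWedge j v).card := by
  let W : Fin (s j) → Finset G.V := fun i => ((G.petal j i).map G.start).toFinset.erase (G.base j)
  have hW : ∀ i, (W i).card + 1 = (G.petal j i).length := by
    intro i
    rw [Finset.card_erase_add_one, List.toFinset_card_of_nodup (G.petal_vertices_nodup j i),
      List.length_map]
    rw [List.mem_toFinset]
    exact (G.petal_isPath j i).base_mem (G.petal_ne_nil j i)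
  have hdisj : ∀ i ∈ (Finset.univ : Finset (Fin (s j))), ∀ i' ∈ (Finset.univ : Finset (Fin (s j))),
      i ≠ i' → Disjoint (W i) (W i') := by
    intro i _ i' _ hne
    rw [Finset.disjoint_left]
    intro v hv hv'
    simp only [W, Finset.mem_erase, List.mem_toFinset] at hv hv'
    exact hv.1 (G.petal_vertices_inter j i i' hne v hv.2 hv'.2)
  have h1 : (insert (G.base j) (Finset.univ.biUnion W)).card ≤
      (Finset.univ.filter fun v => G.OnWedge j v).card := by
    refine Finset.card_le_card fun v hv => ?_
    rw [Finset.mem_filter]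
    refine ⟨Finset.mem_univ _, ?_⟩
    rcases Finset.mem_insert.mp hv with rfl | hv
    · exact G.base_onWedge hs j
    · obtain ⟨i, -, hi⟩ := Finset.mem_biUnion.mp hv
      exact ⟨i, by simpa [W] using (Finset.mem_erase.mp hi).2⟩
  rw [Finset.card_insert_of_notMem (by simp [W]), Finset.card_biUnion hdisj] at h1
  have h2 : ∑ i, (G.petal j i).length = ∑ i, (W i).card + s j := by
    rw [Finset.sum_congr rfl fun i _ => (hW i).symm, Finset.sum_add_distrib]
    simp
  omega

theorem sum_length_petal (h : ∀ e, G.block e ≠ none) :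
    ∑ j, ∑ i, (G.petal j i).length = Fintype.card G.E := by
  classical
  have h1 : ∀ p : Σ j : Fin k, Fin (s j), (G.petal p.1 p.2).length =
      (Finset.univ.filter fun e => G.block e = some p).card := by
    intro p
    rw [← List.length_map (f := Prod.fst),
      ← List.toFinset_card_of_nodup (G.petal_edges_nodup p.1 p.2)]
    congr 1
    ext e
    rw [List.mem_toFinset, Finset.mem_filter, block_eq_some_iff]
    simp
  rw [← Fintype.sum_sigma fun p : Σ j : Fin k, Fin (s j) => (G.petal p.1 p.2).length]
  have h2 := Finset.card_eq_sum_card_fiberwise (f := G.block) (s := Finset.univ)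
    (t := Finset.univ) (by simp)
  rw [Finset.card_univ, Fintype.sum_option] at h2
  rw [h2, Finset.card_eq_zero.mpr, zero_add]
  · exact Finset.sum_congr rfl fun p _ => h1 p
  · rw [Finset.filter_eq_empty_iff]
    exact fun e _ => h e

/-- If all edges lie on the wedges then the rank is at most the sum of the ranks of the wedges. -/
theorem rank_le_of_block_ne_none (hs : ∀ j, 1 ≤ s j) (hk : 1 ≤ k) (h : ∀ e, G.block e ≠ none) :
    n ≤ ∑ j, s j := by
  classical
  have h1 := G.sum_length_petal h
  have h2 := G.sum_wedgeCount_lt hk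
  have h3 : ∑ j, (Finset.univ.filter fun v => G.OnWedge j v).card = ∑ v, G.wedgeCount v := by
    simp only [wedgeCount, Finset.card_filter]
    exact Finset.sum_comm
  -- Summed over the wedges: `E + k ≤ ∑ s j + ∑ wedgeCount ≤ ∑ s j + k + V - 1`.
  have h4 := Finset.sum_le_sum fun j (_ : j ∈ Finset.univ) => G.sum_length_petal_lt hs j
  rw [Finset.sum_add_distrib, Finset.sum_add_distrib, h1, h3] at h4
  have h5 := G.rank_eq
  simp only [Finset.sum_const, Finset.card_univ, Fintype.card_fin, smul_eq_mul, mul_one] at h4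
  omega

theorem mem_or_rev_mem_of_fst_mem {j : Fin k} {i : Fin (s j)} {d : G.Dart}
    (h : d.1 ∈ (G.petal j i).map Prod.fst) :
    d ∈ G.petal j i ∨ rev d ∈ G.petal j i := by
  obtain ⟨d', hd', h⟩ := List.mem_map.mp h
  rcases eq_or_eq_rev h.symm with rfl | rfl
  · exact Or.inl hd'
  · exact Or.inr hd'

theorem onWedge_start {j : Fin k} {i : Fin (s j)} {d : G.Dart}
    (h : d.1 ∈ (G.petal j i).map Prod.fst) : G.start d ∈ (G.petal j i).map G.start := by
  rcases G.mem_or_rev_mem_of_fst_mem h with h | h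
  · exact List.mem_map_of_mem h
  · rw [← (G.petal_isPath j i).map_finish_perm.mem_iff, ← finish_rev]
    exact List.mem_map_of_mem h

/-- If all edges lie on the wedges then a vertex is a meeting point of wedges or the basepoint of
a wedge with at least two petals. -/
theorem exists_base_eq (h : ∀ e, G.block e ≠ none) {v : G.V} (hv : v ∉ G.meeting) :
    ∃ j, 2 ≤ s j ∧ G.base j = v := by
  classical
  by_contra! hb
  have h3 := G.three_le_valence v
  rw [valence_eq_card_darts] at h3
  obtain ⟨a, b, c, ha, hb', hc, hab, hac, hbc⟩ := Finset.two_lt_card_iff.mp h3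
  simp only [Finset.mem_filter, Finset.mem_univ, true_and] at ha hb' hc
  have hblock : ∀ d : G.Dart, ∃ p : Σ j : Fin k, Fin (s j),
      d.1 ∈ (G.petal p.1 p.2).map Prod.fst := by
    intro d
    obtain ⟨p, hp⟩ := Option.ne_none_iff_exists'.mp (h d.1)
    exact ⟨p, G.block_eq_some_iff.mp hp⟩
  obtain ⟨⟨j, i⟩, hp⟩ := hblock a
  -- All half edges at `v` lie on one petal: a second wedge would make `v` a meeting point, a second
  -- petal of the same wedge would make it a basepoint excluded by `hb`.
  have hall : ∀ d, G.start d = v → d.1 ∈ (G.petal j i).map Prod.fst := by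
    intro d hd
    obtain ⟨⟨j', i'⟩, hp'⟩ := hblock d
    have h4 := G.onWedge_start hp
    have h5 := G.onWedge_start hp'
    rw [ha] at h4
    rw [hd] at h5
    by_cases hj : j = j'
    · subst hj
      by_cases hi : i = i'
      · subst hi
        exact hp'
      · have h6 := G.petal_vertices_inter j i i' hi v h4 h5
        have h7 : ¬ 2 ≤ s j := fun h7 => hb j h7 h6.symm
        have := i.2
        have := i'.2
        exact (hi (Fin.ext (by omega))).elim
    · exact (hv ⟨j, j', hj, ⟨i, h4⟩, ⟨i', h5⟩⟩).elim
  have hnd1 := G.petal_vertices_nodup j i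
  have hnd2 : ((G.petal j i).map G.finish).Nodup :=
    (G.petal_isPath j i).map_finish_perm.nodup_iff.mpr hnd1
  have inj1 : ∀ x y, x ∈ G.petal j i → y ∈ G.petal j i → G.start x = v → G.start y = v → x = y :=
    fun x y hx hy h1 h2 => List.inj_on_of_nodup_map hnd1 hx hy (h1.trans h2.symm)
  have inj2 : ∀ x y, rev x ∈ G.petal j i → rev y ∈ G.petal j i → G.start x = v →
      G.start y = v → x = y := fun x y hx hy h1 h2 => rev_injective
    (List.inj_on_of_nodup_map hnd2 hx hy (by rw [finish_rev, finish_rev, h1, h2]))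
  -- An embedded circle leaves `v` only once and enters it only once, so two of the three half edges
  -- coincide.
  rcases G.mem_or_rev_mem_of_fst_mem (hall a ha) with h1 | h1 <;>
  rcases G.mem_or_rev_mem_of_fst_mem (hall b hb') with h2 | h2 <;>
  rcases G.mem_or_rev_mem_of_fst_mem (hall c hc) with h3 | h3
  · exact hab (inj1 _ _ h1 h2 ha hb')
  · exact hab (inj1 _ _ h1 h2 ha hb')
  · exact hac (inj1 _ _ h1 h3 ha hc)
  · exact hbc (inj2 _ _ h2 h3 hb' hc)
  · exact hbc (inj1 _ _ h2 h3 hb' hc)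
  · exact hac (inj2 _ _ h1 h3 ha hc)
  · exact hab (inj2 _ _ h1 h2 ha hb')
  · exact hab (inj2 _ _ h1 h2 ha hb')

/-- There are at most `k - 1` meeting points, and all other vertices are basepoints of wedges with
at least two petals. -/
theorem card_vertices_lt (hk : 1 ≤ k) (h : ∀ e, G.block e ≠ none) :
    Fintype.card G.V + 1 ≤ (Finset.univ.filter fun j => 2 ≤ s j).card + k := by
  classical
  have h1 := G.card_meeting_lt hk
  have h2 : Finset.univ ⊆ (Finset.univ.filter fun v => v ∈ G.meeting) ∪
      (Finset.univ.filter fun j => 2 ≤ s j).image G.base := by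
    intro v _
    by_cases hv : v ∈ G.meeting
    · exact Finset.mem_union_left _ (by simpa using hv)
    · obtain ⟨j, hj, rfl⟩ := G.exists_base_eq h hv
      exact Finset.mem_union_right _ (Finset.mem_image_of_mem _ (by simpa using hj))
  have h3 := (Finset.card_le_card h2).trans (Finset.card_union_le _ _)
  have h4 := Finset.card_image_le (s := Finset.univ.filter fun j => 2 ≤ s j) (f := G.base)
  rw [Finset.card_univ] at h3
  omega

end RelGraph

/-! ### Cycles against coboundaries: the rank forced by a non-separating outside edge. -/

namespace FinGraph

variable (Γ : FinGraph)

/-- The coboundary map. -/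
def coboundary : (Γ.V → ℝ) →ₗ[ℝ] (Γ.E → ℝ) where
  toFun f e := f (Γ.tgt e) - f (Γ.src e)
  map_add' f g := by
    ext e
    simp only [Pi.add_apply]
    ring
  map_smul' c f := by
    ext e
    simp only [Pi.smul_apply, smul_eq_mul, RingHom.id_apply]
    ring

/-- The integral of a cochain along an edge path. -/
noncomputable def integral : List Γ.Dart → (Γ.E → ℝ) →ₗ[ℝ] ℝ
  | [] => 0
  | d :: L => (if d.2 then (1 : ℝ) else -1) • LinearMap.proj d.1 + integral L

variable {Γ}

theorem integral_cons (d : Γ.Dart) (L : List Γ.Dart) (l : Γ.E → ℝ) :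
    Γ.integral (d :: L) l = (if d.2 then (1 : ℝ) else -1) * l d.1 + Γ.integral L l := rfl

theorem integral_eq_zero {L : List Γ.Dart} {l : Γ.E → ℝ} (h : ∀ d ∈ L, l d.1 = 0) :
    Γ.integral L l = 0 := by
  induction L with
  | nil => rfl
  | cons d L ih =>
    rw [integral_cons, h d (by simp), ih fun d' hd' => h d' (by simp [hd'])]
    simp

theorem integral_coboundary {u v : Γ.V} {L : List Γ.Dart} (h : Γ.IsPath u L v) (f : Γ.V → ℝ) :
    Γ.integral L (Γ.coboundary f) = f v - f u := by
  induction L generalizing u with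
  | nil =>
    obtain rfl : u = v := h
    rw [sub_self]
    rfl
  | cons d L ih =>
    obtain ⟨rfl, h2⟩ := h
    rw [integral_cons, ih h2]
    obtain ⟨e, b⟩ := d
    cases b <;> simp [coboundary, start, finish]

/-- On a connected graph only constants have coboundary zero, since integrating along a path
recovers differences of values. -/
theorem Connected.card_le_finrank_range_coboundary (h : Γ.Connected) :
    Fintype.card Γ.V ≤ Module.finrank ℝ (LinearMap.range Γ.coboundary) + 1 := by
  have h1 := Γ.coboundary.finrank_range_add_finrank_ker
  rw [Module.finrank_fintype_fun_eq_card] at h1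
  have h2 : LinearMap.ker Γ.coboundary ≤ Submodule.span ℝ {fun _ => (1 : ℝ)} := by
    intro f hf
    obtain ⟨⟨v₀⟩, h⟩ := h
    rw [Submodule.mem_span_singleton]
    refine ⟨f v₀, ?_⟩
    ext v
    obtain ⟨L, hL⟩ := h v₀ v
    have h3 := integral_coboundary hL f
    rw [LinearMap.mem_ker.mp hf, map_zero] at h3
    simp only [Pi.smul_apply, smul_eq_mul, mul_one]
    linarith
  have h3 := Submodule.finrank_mono h2
  have h4 := finrank_span_le_card (R := ℝ) ({fun _ => (1 : ℝ)} : Set (Γ.V → ℝ))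
  simp only [Set.toFinset_singleton, Finset.card_singleton] at h4
  omega

end FinGraph

namespace RelGraph

variable {n k : ℕ} {s : Fin k → ℕ} (G : RelGraph n s)

/-- A signed indicator of the first edge of the petal works, as that edge is passed once and lies on
no other petal. -/
theorem exists_integral_petal_eq (p : Σ j : Fin k, Fin (s j)) : ∃ l : G.E → ℝ,
    G.integral (G.petal p.1 p.2) l = 1 ∧ ∀ p', p' ≠ p → G.integral (G.petal p'.1 p'.2) l = 0 := by
  classical
  obtain ⟨d, L, hL⟩ := List.exists_cons_of_ne_nil (G.petal_ne_nil p.1 p.2)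
  refine ⟨Pi.single d.1 (if d.2 then (1 : ℝ) else -1), ?_, fun p' hp' => ?_⟩
  · have hnd := G.petal_edges_nodup p.1 p.2
    rw [hL, List.map_cons, List.nodup_cons] at hnd
    rw [hL, integral_cons, integral_eq_zero, Pi.single_eq_same]
    · split_ifs <;> norm_num
    · intro d' hd'
      rw [Pi.single_eq_of_ne]
      exact fun h => hnd.1 (h ▸ List.mem_map_of_mem hd')
  · apply integral_eq_zero
    intro d' hd'
    rw [Pi.single_eq_of_ne]
    intro h
    refine hp' (G.petal_unique (e := d.1) (h ▸ List.mem_map_of_mem hd') ?_)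
    rw [hL]
    simp

/-- A non-separating edge outside the wedges contributes to the rank. -/
theorem rank_of_not_isSeparating {e₀ : G.E} (h₀ : G.block e₀ = none) (hsep : ¬ G.IsSeparating e₀) :
    ∑ j, s j + 1 ≤ n := by
  classical
  obtain ⟨L, hL, hne⟩ := not_not.mp hsep
  choose u hu hu' using G.exists_integral_petal_eq
  -- The periods over all petals and over the cycle formed by `L` and the reversed edge `e₀`. They
  -- are independent, so `ker Φ` has codimension `∑ s j + 1`; it contains the coboundaries, of
  -- dimension at least `V - 1`.
  let Φ : (G.E → ℝ) →ₗ[ℝ] (Option (Σ j : Fin k, Fin (s j)) → ℝ) := LinearMap.pi fun b =>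
    b.elim (G.integral L - LinearMap.proj e₀) fun p => G.integral (G.petal p.1 p.2)
  have hΦ : LinearMap.range Φ = ⊤ := by
    rw [LinearMap.range_eq_top]
    intro y
    let l₁ : G.E → ℝ := ∑ p, y (some p) • u p
    -- The indicator of `e₀` has period `-1` over the extra cycle and `0` over every petal, so it
    -- corrects the last coordinate alone.
    let c : ℝ := G.integral L l₁ - l₁ e₀ - y none
    refine ⟨l₁ + c • Pi.single e₀ 1, ?_⟩
    ext b
    rcases b with _ | p
    · change G.integral L (l₁ + c • Pi.single e₀ 1) -
        (l₁ + c • Pi.single e₀ 1 : G.E → ℝ) e₀ = y none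
      have h1 : G.integral L (Pi.single e₀ 1) = 0 :=
        integral_eq_zero fun d hd => Pi.single_eq_of_ne (hne d hd) _
      rw [map_add, map_smul, h1]
      simp only [Pi.add_apply, Pi.smul_apply, Pi.single_eq_same, smul_eq_mul,
        mul_one, c]
      ring
    · change G.integral (G.petal p.1 p.2) (l₁ + c • Pi.single e₀ 1) = y (some p)
      have h1 : G.integral (G.petal p.1 p.2) (Pi.single e₀ 1) = 0 := by
        refine integral_eq_zero fun d hd => Pi.single_eq_of_ne ?_ _
        rintro rfl
        exact G.block_eq_none_iff.mp h₀ p.1 p.2 (List.mem_map_of_mem hd)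
      rw [map_add, map_smul, h1, map_sum, Finset.sum_eq_single p, map_smul, hu]
      · simp
      · intro q _ hq
        rw [map_smul, hu' q p hq.symm, smul_zero]
      · simp
  have hker : LinearMap.range G.coboundary ≤ LinearMap.ker Φ := by
    rintro _ ⟨f, rfl⟩
    rw [LinearMap.mem_ker]
    ext b
    rcases b with _ | p
    · change G.integral L (G.coboundary f) - G.coboundary f e₀ = 0
      rw [integral_coboundary hL, sub_eq_zero]
      rfl
    · change G.integral (G.petal p.1 p.2) (G.coboundary f) = 0
      rw [integral_coboundary (G.petal_isPath p.1 p.2), sub_self]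
  have h1 := Φ.finrank_range_add_finrank_ker
  have h2 := Submodule.finrank_mono hker
  have h3 := G.connected.card_le_finrank_range_coboundary
  rw [hΦ, finrank_top, Module.finrank_fintype_fun_eq_card, Module.finrank_fintype_fun_eq_card] at h1
  simp only [Fintype.card_option, Fintype.card_sigma, Fintype.card_fin] at h1
  have h5 := G.rank_eq
  omega

end RelGraph

/-! ### Upper bounds for the dimension. -/

namespace MarkedGraph

variable {n k : ℕ} {s : Fin k → ℕ} (G : MarkedGraph n s)

theorem outside_nonempty (hs : ∀ j, 1 ≤ s j) (h : ∑ j, s j < n) : G.outside.Nonempty := by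
  by_contra hne
  rw [Set.not_nonempty_iff_eq_empty] at hne
  have hb : ∀ e, G.block e ≠ none := by
    intro e he
    have : e ∈ G.outside := G.block_eq_none_iff.mp he
    simp [hne] at this
  rcases Nat.eq_zero_or_pos k with rfl | hk
  -- Without wedges there would be no edges at all, contrary to the valence condition.
  · obtain ⟨⟨v⟩, -⟩ := G.connected
    have h1 := G.sum_length_petal hb
    have h2 := Finset.single_le_sum (f := G.valence) (fun _ _ => Nat.zero_le _)
      (Finset.mem_univ v)
    rw [sum_valence, ← h1] at h2
    have h3 := G.three_le_valence v
    simp at h2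
    omega
  · have := G.rank_le_of_block_ne_none hs hk hb
    omega

theorem polysimplexDim_le (hs : ∀ j, 1 ≤ s j) (h : ∑ j, s j < n) :
    G.polysimplexDim + 3 * ∑ j, s j + (Finset.univ.filter fun j => s j = 1).card + 4 ≤
      3 * n + 3 * k := by
  have h1 := G.polysimplexDim_of_outside_nonempty (G.outside_nonempty hs h)
  have h2 := G.card_edges_le hs
  omega

theorem outside_eq_empty_of_reduced (h : n = ∑ j, s j) (hG : ∀ e, ¬ G.IsSeparating e) :
    G.outside = ∅ := by
  rw [Set.eq_empty_iff_forall_notMem]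
  intro e he
  have := G.rank_of_not_isSeparating (G.block_eq_none_iff.mpr he) (hG e)
  omega

/-- With no outside edges and `n = ∑ s j`, the dimension is `E - n = V - 1`. -/
theorem polysimplexDim_le_of_reduced (hn : 2 ≤ n) (hs : ∀ j, 1 ≤ s j) (h : n = ∑ j, s j)
    (hG : ∀ e, ¬ G.IsSeparating e) :
    G.polysimplexDim + (Finset.univ.filter fun j => s j = 1).card + 2 ≤ 2 * k := by
  have h0 := G.outside_eq_empty_of_reduced h hG
  have h1 := G.polysimplexDim_of_outside_eq_empty h0
  have hk : 1 ≤ k := by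
    rcases Nat.eq_zero_or_pos k with rfl | hk
    · simp at h
      omega
    · exact hk
  have h2 := G.card_vertices_lt hk fun e he => by
    have : e ∈ G.outside := G.block_eq_none_iff.mp he
    simp [h0] at this
  have h3 := Finset.card_filter_add_card_filter_not (s := Finset.univ) (fun j => s j = 1)
  have h4 : (Finset.univ.filter fun j => ¬ s j = 1) = Finset.univ.filter fun j => 2 ≤ s j := by
    refine Finset.filter_congr fun j _ => ?_
    have := hs j
    omega
  rw [h4, Finset.card_univ, Fintype.card_fin] at h3
  have h5 := G.rank_eq
  omega

end MarkedGraph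

/-! ### Blueprints: building marked graphs from combinatorial data. -/

/-- A highest vertex of a cycle would have two different lower neighbours. -/
theorem isAcyclic_of_height {W : Type*} {F : SimpleGraph W} (h : W → ℕ)
    (hne : ∀ a b, F.Adj a b → h a ≠ h b)
    (huniq : ∀ a b c, F.Adj a b → F.Adj a c → h b < h a → h c < h a → b = c) :
    F.IsAcyclic := by
  classical
  intro v c hc
  obtain ⟨u, hu, hmax⟩ := c.support.toFinset.exists_max_image h ⟨v, by simp⟩
  rw [List.mem_toFinset] at hu
  have hc' := hc.rotate hu
  have hlt : ∀ w, F.Adj u w → w ∈ (c.rotate u hu).support → h w < h u := by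
    intro w hw hmem
    refine lt_of_le_of_ne (hmax w ?_) (hne u w hw).symm
    rw [List.mem_toFinset]
    exact (SimpleGraph.Walk.mem_support_rotate_iff _ _ hu).mp hmem
  have h1 := (c.rotate u hu).adj_snd hc'.not_nil
  have h2 := (c.rotate u hu).adj_penultimate hc'.not_nil
  exact hc'.snd_ne_penultimate (huniq u _ _ h1 h2.symm
    (hlt _ h1 (SimpleGraph.Walk.getVert_mem_support _ _))
    (hlt _ h2.symm (SimpleGraph.Walk.getVert_mem_support _ _)))

/-- A sufficient condition for an incidence graph to be a forest: each point `w` has a distinguished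
element of the largest index `up w`, and each element has at most one point of smaller index. -/
theorem isAcyclic_incidence {J P : Type*} (on : J → P → Prop) (h : J → ℕ)
    (hinj : Function.Injective h) (up : P → ℕ) (up_le : ∀ j w, on j w → up w ≤ h j)
    (up_unique : ∀ j v w, on j v → on j w → up v < h j → up w < h j → v = w) :
    (SimpleGraph.fromRel fun a b : J ⊕ P =>
      ∃ j w, a = Sum.inl j ∧ b = Sum.inr w ∧ on j w).IsAcyclic := by
  have hadj : ∀ a b : J ⊕ P, (SimpleGraph.fromRel fun a b : J ⊕ P =>
      ∃ j w, a = Sum.inl j ∧ b = Sum.inr w ∧ on j w).Adj a b → ∃ j w, on j w ∧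
        ((a = Sum.inl j ∧ b = Sum.inr w) ∨ (a = Sum.inr w ∧ b = Sum.inl j)) := by
    rintro a b ⟨-, ⟨j, w, ha, hb, h⟩ | ⟨j, w, hb, ha, h⟩⟩
    · exact ⟨j, w, h, Or.inl ⟨ha, hb⟩⟩
    · exact ⟨j, w, h, Or.inr ⟨ha, hb⟩⟩
  -- Parity separates wedges from points. A point `w` is above only a wedge of index exactly `up w`,
  -- and a wedge is above only points with `up` smaller than its index.
  refine isAcyclic_of_height (Sum.elim (fun j => 2 * h j) fun w => 2 * up w + 1) ?_ ?_
  · intro a b hab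
    obtain ⟨j, w, -, ⟨rfl, rfl⟩ | ⟨rfl, rfl⟩⟩ := hadj a b hab
    · simp only [Sum.elim_inl, Sum.elim_inr]
      omega
    · simp only [Sum.elim_inl, Sum.elim_inr]
      omega
  · intro a b c hab hac hb hc
    obtain ⟨j, w, h1, ⟨rfl, rfl⟩ | ⟨rfl, rfl⟩⟩ := hadj a b hab
    · obtain ⟨j', w', h2, ⟨h3, rfl⟩ | ⟨h3, rfl⟩⟩ := hadj _ c hac
      · obtain rfl := Sum.inl_injective h3
        simp only [Sum.elim_inl, Sum.elim_inr] at hb hc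
        rw [up_unique j w w' h1 h2 (by omega) (by omega)]
      · exact (Sum.inl_ne_inr h3).elim
    · obtain ⟨j', w', h2, ⟨h3, rfl⟩ | ⟨h3, rfl⟩⟩ := hadj _ c hac
      · exact (Sum.inr_ne_inl h3).elim
      · obtain rfl := Sum.inr_injective h3
        simp only [Sum.elim_inl, Sum.elim_inr] at hb hc
        have u1 := up_le j w h1
        have u2 := up_le j' w h2
        rw [hinj (show h j = h j' by omega)]

/-- A recipe for a relative graph: the first circle of the `j`-th wedge runs through the points
`pt j 0, …, pt j (r j)`. The basepoint of the wedge is a further vertex on this circle if `flag j`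
holds and the point `pt j 0` otherwise, and the other circles of the wedge are loops there. The
edges in `Extra` are the edges outside the wedges. -/
structure Blueprint (k : ℕ) where
  X : Type
  Extra : Type
  [finX : Fintype X]
  [finExtra : Fintype Extra]
  esrc : Extra → X
  etgt : Extra → X
  r : Fin k → ℕ
  pt : Fin k → ℕ → X
  flag : Fin k → Bool

attribute [instance] Blueprint.finX Blueprint.finExtra

namespace Blueprint

variable {k : ℕ} (D : Blueprint k) (s : Fin k → ℕ)

abbrev Vert : Type := D.X ⊕ {j : Fin k // D.flag j = true}

abbrev Edge : Type :=
  ((Σ j : Fin k, Fin (D.r j + 1)) ⊕ {j : Fin k // D.flag j = true}) ⊕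
    ((Σ j : Fin k, Fin (s j - 1)) ⊕ D.Extra)

variable {s} in
def arc (j : Fin k) (i : Fin (D.r j + 1)) : D.Edge s := Sum.inl (Sum.inl ⟨j, i⟩)

variable {s} in
def entry (j : {j : Fin k // D.flag j = true}) : D.Edge s := Sum.inl (Sum.inr j)

variable {s} in
def petalLoop (j : Fin k) (i : Fin (s j - 1)) : D.Edge s := Sum.inr (Sum.inl ⟨j, i⟩)

variable {s} in
def extra (e : D.Extra) : D.Edge s := Sum.inr (Sum.inr e)

def base (j : Fin k) : D.Vert :=
  if h : D.flag j = true then Sum.inr ⟨j, h⟩ else Sum.inl (D.pt j 0)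

/-- The `i`-th corner after the entry of the first circle of the `j`-th wedge. -/
def corner (j : Fin k) (i : ℕ) : D.Vert :=
  if i ≤ D.r j then Sum.inl (D.pt j i) else D.base j

abbrev graph : FinGraph where
  V := D.Vert
  E := D.Edge s
  src := Sum.elim (Sum.elim (fun p => D.corner p.1 p.2) Sum.inr)
    (Sum.elim (fun p => D.base p.1) fun e => Sum.inl (D.esrc e))
  tgt := Sum.elim (Sum.elim (fun p => D.corner p.1 (p.2 + 1)) fun j => D.corner j.1 0)
    (Sum.elim (fun p => D.base p.1) fun e => Sum.inl (D.etgt e))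

variable {s}

def entryArcs (j : Fin k) : List (D.Edge s × Bool) :=
  if h : D.flag j = true then [(D.entry ⟨j, h⟩, true)] else []

/-- The first circle of the `j`-th wedge without its last edge. -/
def initialArcs (j : Fin k) : List (D.Edge s × Bool) :=
  D.entryArcs j ++ List.ofFn fun i : Fin (D.r j) => (D.arc j i.castSucc, true)

def petal (j : Fin k) (i : Fin (s j)) : List (D.Edge s × Bool) :=
  if h : i.1 = 0 then D.initialArcs j ++ [(D.arc j (Fin.last _), true)]
  else [(D.petalLoop j ⟨i.1 - 1, by omega⟩, true)]

theorem petal_zero {j : Fin k} {i : Fin (s j)} (h : i.1 = 0) : D.petal j i =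
    D.entryArcs j ++ List.ofFn fun i : Fin (D.r j + 1) => (D.arc j i, true) := by
  rw [petal, dif_pos h, initialArcs, List.ofFn_succ', List.append_assoc, List.concat_eq_append]

/-- The petal which contains a given edge. -/
def owner : D.Edge s → Option (Fin k × ℕ) :=
  Sum.elim (Sum.elim (fun p => some (p.1, 0)) fun j => some (j.1, 0))
    (Sum.elim (fun p => some (p.1, p.2.1 + 1)) fun _ => none)

theorem owner_eq {j : Fin k} {i : Fin (s j)} {e : D.Edge s}
    (he : e ∈ (D.petal j i).map Prod.fst) : D.owner e = some (j, i.1) := by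
  by_cases h : i.1 = 0
  · rw [petal_zero D h, List.map_append, List.mem_append] at he
    rw [h]
    rcases he with he | he
    · rw [entryArcs] at he
      split_ifs at he
      · obtain rfl : e = _ := by simpa using he
        rfl
      · simp at he
    · simp only [List.map_ofFn, List.mem_ofFn, Function.comp_apply] at he
      obtain ⟨i, rfl⟩ := he
      rfl
  · rw [petal, dif_neg h] at he
    obtain rfl : e = _ := by simpa using he
    simp only [owner, petalLoop, Sum.elim_inr, Sum.elim_inl]
    congr 2
    omega

theorem mem_petal_of_owner_ne_none (hs : ∀ j, 1 ≤ s j) {e : D.Edge s} (he : D.owner e ≠ none) :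
    ∃ j, ∃ i : Fin (s j), e ∈ (D.petal j i).map Prod.fst := by
  rcases e with (⟨j, i⟩ | ⟨j, hj⟩) | (⟨j, i⟩ | e)
  · refine ⟨j, ⟨0, hs j⟩, ?_⟩
    rw [petal_zero D rfl, List.map_append, List.map_ofFn, List.mem_append, List.mem_ofFn]
    exact Or.inr ⟨i, rfl⟩
  · refine ⟨j, ⟨0, hs j⟩, ?_⟩
    rw [petal_zero D rfl, List.map_append, List.mem_append, entryArcs, dif_pos hj]
    exact Or.inl (List.mem_singleton.mpr rfl)
  · refine ⟨j, ⟨i.1 + 1, by omega⟩, ?_⟩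
    rw [petal, dif_neg (by simp)]
    exact List.mem_singleton.mpr rfl
  · exact (he rfl).elim

theorem base_eq_corner (j : Fin k) (h : ¬ D.flag j = true) : D.base j = D.corner j 0 := by
  simp [base, corner, h]

theorem isPath_petal (j : Fin k) (i : Fin (s j)) :
    (D.graph s).IsPath (D.base j) (D.petal j i) (D.base j) := by
  by_cases h : i.1 = 0
  · have h1 := IsPath.ofFn (Γ := D.graph s) (fun i : Fin (D.r j + 1) => (D.arc j i, true))
      (D.corner j) (fun i => rfl) (fun i => rfl)
    have h2 : D.corner j (D.r j + 1) = D.base j := by simp [corner]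
    rw [h2] at h1
    rw [petal_zero D h, entryArcs]
    split_ifs with hf
    · refine ⟨?_, h1⟩
      rw [base, dif_pos hf]
      rfl
    · rw [base_eq_corner D j hf] at h1 ⊢
      exact h1
  · rw [petal, dif_neg h]
    exact ⟨rfl, rfl⟩

theorem map_start_petal_zero {j : Fin k} {i : Fin (s j)} (h : i.1 = 0) :
    (D.petal j i).map (D.graph s).start =
      (if h : D.flag j = true then [Sum.inr ⟨j, h⟩] else []) ++
        List.ofFn fun i : Fin (D.r j + 1) => Sum.inl (D.pt j i) := by
  rw [petal_zero D h, List.map_append, List.map_ofFn, entryArcs]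
  congr 1
  · split_ifs <;> rfl
  · congr 1
    ext i : 1
    change D.corner j i = _
    rw [corner, if_pos (by omega)]

theorem eq_of_mem_start {j : Fin k} {i : Fin (s j)} {v : D.Vert}
    (hv : v ∈ (D.petal j i).map (D.graph s).start) :
    (∃ h, v = Sum.inr ⟨j, h⟩) ∨ ∃ t ≤ D.r j, v = Sum.inl (D.pt j t) := by
  by_cases h : i.1 = 0
  · rw [map_start_petal_zero D h, List.mem_append, List.mem_ofFn] at hv
    rcases hv with hv | ⟨t, rfl⟩
    · split_ifs at hv with hf
      · exact Or.inl ⟨hf, by simpa using hv⟩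
      · simp at hv
    · exact Or.inr ⟨t, by omega, rfl⟩
  · rw [petal, dif_neg h] at hv
    obtain rfl : v = D.base j := List.mem_singleton.mp hv
    rw [base]
    split_ifs with hf
    · exact Or.inl ⟨hf, rfl⟩
    · exact Or.inr ⟨0, Nat.zero_le _, rfl⟩

/-- The conditions under which a blueprint describes a relative graph of rank `n`. The function
`up` describes the dual forest: `up x` is the wedge above the point `x`. -/
structure Valid (D : Blueprint k) (s : Fin k → ℕ) (n : ℕ) where
  one_le : ∀ j, 1 ≤ s j
  two_le : ∀ j, D.flag j = true → 2 ≤ s j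
  -- The flagged basepoints cancel: each adds one vertex and one edge.
  rank : ∑ j, D.r j + ∑ j, s j + Fintype.card D.Extra + 1 = Fintype.card D.X + n
  pt_inj : ∀ j i i', i ≤ D.r j → i' ≤ D.r j → D.pt j i = D.pt j i' → i = i'
  valence : ∀ x, 3 ≤ (D.graph s).valence (Sum.inl x)
  up : D.X → ℕ
  up_le : ∀ j, ∀ i ≤ D.r j, up (D.pt j i) ≤ j
  up_unique : ∀ j, ∀ i ≤ D.r j, ∀ i' ≤ D.r j, up (D.pt j i) ≠ j → up (D.pt j i') ≠ j →
    D.pt j i = D.pt j i'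
  root : D.X
  parent : D.X → (D.graph s).Dart
  height : D.X → ℕ
  finish_parent : ∀ x, x ≠ root → (D.graph s).finish (parent x) = Sum.inl x
  start_parent : ∀ x, x ≠ root →
    ∃ y, (D.graph s).start (parent x) = Sum.inl y ∧ height y < height x
  -- With the next field: the tree contains all arcs of each first circle except the last, and no
  -- petal loop.
  parent_form : ∀ x, x ≠ root → (∃ j, ∃ i : Fin (D.r j), (parent x).1 = D.arc j i.castSucc) ∨
    ∃ e, (parent x).1 = D.extra e
  arc_parent : ∀ j, ∀ i : Fin (D.r j), ∃ x, x ≠ root ∧ (parent x).1 = D.arc j i.castSucc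

theorem card_edge (hs : ∀ j, 1 ≤ s j) : Fintype.card (D.Edge s) =
    ∑ j, D.r j + ∑ j, s j + (Finset.univ.filter fun j => D.flag j = true).card +
      Fintype.card D.Extra := by
  have h1 : ∑ j, (D.r j + 1) + ∑ j, (s j - 1) = ∑ j, D.r j + ∑ j, s j := by
    rw [← Finset.sum_add_distrib, ← Finset.sum_add_distrib]
    refine Finset.sum_congr rfl fun j _ => ?_
    have := hs j
    omega
  simp only [Fintype.card_sum, Fintype.card_sigma, Fintype.card_fin, Fintype.card_subtype]
  omega

namespace Valid

variable {D} {n : ℕ} (H : Valid D s n)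

/-- Flagged basepoints are hung as leaves, through their reversed entry edges, on the tree of the
points. -/
def spanningTree : SpanningTree (D.graph s) where
  root := Sum.inl H.root
  parent := Sum.elim H.parent fun j => (D.entry j, false)
  height := Sum.elim H.height fun j => H.height (D.pt j.1 0) + 1
  finish_parent := by
    rintro (x | j) hv
    · exact H.finish_parent x fun h => hv (congrArg Sum.inl h)
    · rfl
  height_lt := by
    rintro (x | j) hv
    · obtain ⟨y, hy, hlt⟩ := H.start_parent x fun h => hv (congrArg Sum.inl h)
      rw [Sum.elim_inl, hy]
      exact hlt
    · have h : (D.graph s).start (D.entry j, false) = Sum.inl (D.pt j.1 0) := by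
        change D.corner j.1 0 = _
        simp [corner]
      rw [Sum.elim_inr, h]
      exact Nat.lt_succ_self _

/-- At a common point `up` is at most both indices, hence below the larger one. So there is a wedge
from whose index both values differ, and `up_unique` for it identifies the points. -/
theorem wedge_inter {D : Blueprint k} {n : ℕ} (H : Valid D s n)
    {j j' : Fin k} (hne : j ≠ j') {i₁ i₂ i₃ i₄ : ℕ}
    (h₁ : i₁ ≤ D.r j)
    (h₂ : i₂ ≤ D.r j') (h₃ : i₃ ≤ D.r j) (h₄ : i₄ ≤ D.r j') (h : D.pt j i₁ = D.pt j' i₂)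
    (h' : D.pt j i₃ = D.pt j' i₄) : D.pt j i₁ = D.pt j i₃ := by
  have hne' : j.1 ≠ j'.1 := fun h => hne (Fin.ext h)
  have u1 := H.up_le j i₁ h₁
  have u2 := H.up_le j' i₂ h₂
  have u3 := H.up_le j i₃ h₃
  have u4 := H.up_le j' i₄ h₄
  by_cases a1 : H.up (D.pt j i₁) = j
  · by_cases a3 : H.up (D.pt j i₃) = j
    · rw [h, h']
      exact H.up_unique j' i₂ h₂ i₄ h₄ (by rw [← h]; omega) (by rw [← h']; omega)
    · rw [h] at a1
      by_cases a4 : H.up (D.pt j' i₄) = j'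
      · rw [h'] at u3
        omega
      · rw [h, h']
        exact H.up_unique j' i₂ h₂ i₄ h₄ (by omega) a4
  · by_cases a3 : H.up (D.pt j i₃) = j
    · rw [h'] at a3
      by_cases a2 : H.up (D.pt j' i₂) = j'
      · rw [h] at u1
        omega
      · rw [h, h']
        exact H.up_unique j' i₂ h₂ i₄ h₄ a2 (by omega)
    · exact H.up_unique j i₁ h₁ i₃ h₃ a1 a3

theorem start_nodup {D : Blueprint k} {n : ℕ} (H : Valid D s n) (j : Fin k) (i : Fin (s j)) :
    ((D.petal j i).map (D.graph s).start).Nodup := by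
  by_cases h : i.1 = 0
  · rw [map_start_petal_zero D h]
    have h1 : (List.ofFn fun i : Fin (D.r j + 1) => (Sum.inl (D.pt j i) : D.Vert)).Nodup := by
      rw [List.nodup_ofFn]
      intro a b hab
      exact Fin.ext (H.pt_inj j a b (by omega) (by omega) (Sum.inl_injective hab))
    split_ifs with hf
    · rw [List.singleton_append, List.nodup_cons]
      refine ⟨?_, h1⟩
      rw [List.mem_ofFn]
      rintro ⟨t, ht⟩
      simp at ht
    · exact h1
  · rw [petal, dif_neg h]
    exact List.nodup_singleton _

theorem edges_nodup (j : Fin k) (i : Fin (s j)) : ((D.petal j i).map Prod.fst).Nodup := by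
  by_cases h : i.1 = 0
  · rw [petal_zero D h, entryArcs, List.map_append, List.map_ofFn]
    have h1 : (List.ofFn (Prod.fst ∘ fun i : Fin (D.r j + 1) =>
        ((D.arc j i, true) : D.Edge s × Bool))).Nodup := by
      rw [List.nodup_ofFn]
      intro a b hab
      simpa [arc] using hab
    split_ifs with hf
    · rw [List.map_singleton, List.singleton_append, List.nodup_cons]
      refine ⟨?_, h1⟩
      rw [List.mem_ofFn]
      rintro ⟨t, ht⟩
      simp [arc, entry] at ht
    · exact h1
  · rw [petal, dif_neg h]
    exact List.nodup_singleton _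

theorem three_le_valence {D : Blueprint k} {n : ℕ} (H : Valid D s n) (v : D.Vert) :
    3 ≤ (D.graph s).valence v := by
  rcases v with x | ⟨j, hj⟩
  · exact H.valence x
  · have h2 := H.two_le j hj
    have hb : D.base j = Sum.inr ⟨j, hj⟩ := by rw [base, dif_pos hj]
    refine three_le_valence_of_darts (Γ := D.graph s) (D.entry ⟨j, hj⟩, true)
      (D.arc j (Fin.last _), false) (D.petalLoop j ⟨0, by omega⟩, true) rfl ?_ hb ?_ ?_ ?_
    · change D.corner j (D.r j + 1) = _
      rw [corner, if_neg (by omega), hb]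
    all_goals
      intro h
      have := congrArg Prod.fst h
      simp [entry, arc, petalLoop] at this

def relGraph : RelGraph n s where
  toFinGraph := D.graph s
  connected := H.spanningTree.connected
  rank_eq := by
    change Fintype.card (D.Edge s) + 1 = Fintype.card D.Vert + n
    have := H.rank
    rw [D.card_edge H.one_le, Fintype.card_sum, Fintype.card_subtype]
    omega
  three_le_valence := H.three_le_valence
  base := D.base
  petal := D.petal
  petal_isPath := D.isPath_petal
  petal_ne_nil := fun j i => by
    rw [petal]
    split_ifs <;> simp
  petal_vertices_nodup := H.start_nodup
  petal_edges_nodup := edges_nodup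
  petal_vertices_inter := by
    intro j i i' hne v hv hv'
    by_cases h : i.1 = 0
    · have h' : i'.1 ≠ 0 := fun h' => hne (Fin.ext (h.trans h'.symm))
      rw [petal, dif_neg h'] at hv'
      exact List.mem_singleton.mp hv'
    · rw [petal, dif_neg h] at hv
      exact List.mem_singleton.mp hv
  petal_edges_disjoint := by
    intro j i i' hne e he he'
    have h := (D.owner_eq he).symm.trans (D.owner_eq he')
    simp only [Option.some_inj, Prod.mk.injEq, true_and] at h
    exact hne (Fin.ext h)
  wedge_edges_disjoint := by
    intro j j' hne i i' e he he'
    have h := (D.owner_eq he).symm.trans (D.owner_eq he')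
    simp only [Option.some_inj, Prod.mk.injEq] at h
    exact hne h.1
  wedge_vertices_inter := by
    rintro j j' hne v ⟨⟨i₁, hv₁⟩, i₂, hv₂⟩ w ⟨⟨i₃, hv₃⟩, i₄, hv₄⟩
    rcases D.eq_of_mem_start hv₁ with ⟨h1, rfl⟩ | ⟨t₁, ht₁, rfl⟩
    · rcases D.eq_of_mem_start hv₂ with ⟨h2, h⟩ | ⟨t₂, ht₂, h⟩
      · simp only [Sum.inr.injEq, Subtype.mk.injEq] at h
        exact (hne h).elim
      · simp at h
    · rcases D.eq_of_mem_start hv₂ with ⟨h2, h⟩ | ⟨t₂, ht₂, h⟩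
      · simp at h
      · rcases D.eq_of_mem_start hv₃ with ⟨h3, rfl⟩ | ⟨t₃, ht₃, rfl⟩
        · rcases D.eq_of_mem_start hv₄ with ⟨h2, h⟩ | ⟨t₂, ht₂, h⟩
          · simp only [Sum.inr.injEq, Subtype.mk.injEq] at h
            exact (hne h).elim
          · simp at h
        · rcases D.eq_of_mem_start hv₄ with ⟨h2, h'⟩ | ⟨t₄, ht₄, h'⟩
          · simp at h'
          · exact congrArg Sum.inl (H.wedge_inter hne ht₁ ht₂ ht₃ ht₄ (Sum.inl_injective h)
              (Sum.inl_injective h'))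
  dual_isAcyclic := by
    -- A flagged basepoint lies on its own wedge only, so it may take the index of that wedge.
    let up : D.Vert → ℕ := Sum.elim H.up fun j => j.1
    have up_le : ∀ {j : Fin k} {v : D.Vert}, (∃ i, v ∈ (D.petal j i).map (D.graph s).start) →
        up v ≤ j := by
      rintro j v ⟨i, hi⟩
      rcases D.eq_of_mem_start hi with ⟨h, rfl⟩ | ⟨t, ht, rfl⟩
      · exact le_rfl
      · exact H.up_le j t ht
    have up_unique : ∀ {j : Fin k} {v w : D.Vert},
        (∃ i, v ∈ (D.petal j i).map (D.graph s).start) →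
        (∃ i, w ∈ (D.petal j i).map (D.graph s).start) → up v < j → up w < j → v = w := by
      rintro j v w ⟨i, hi⟩ ⟨i', hi'⟩ hv hw
      rcases D.eq_of_mem_start hi with ⟨h, rfl⟩ | ⟨t, ht, rfl⟩
      · exact (lt_irrefl _ hv).elim
      · rcases D.eq_of_mem_start hi' with ⟨h, rfl⟩ | ⟨t', ht', rfl⟩
        · exact (lt_irrefl _ hw).elim
        · exact congrArg Sum.inl (H.up_unique j t ht t' ht' hv.ne hw.ne)
    exact isAcyclic_incidence _ Fin.val Fin.val_injective (fun w => up w.1) (fun _ _ => up_le)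
      fun _ _ _ h1 h2 h3 h4 => Subtype.ext (up_unique h1 h2 h3 h4)

theorem exists_markedGraph {D : Blueprint k} {n : ℕ} (H : Valid D s n)
    (hex : ∀ e, ¬ (D.graph s).IsSeparating (D.extra e)) :
    ∃ G : MarkedGraph n s, (∀ e, ¬ G.IsSeparating e) ∧ Fintype.card G.E =
      ∑ j, D.r j + ∑ j, s j + (Finset.univ.filter fun j => D.flag j = true).card +
        Fintype.card D.Extra := by
  have hroot : ∀ x, x ≠ H.root → (Sum.inl x : D.Vert) ≠ Sum.inl H.root :=
    fun x hx h => hx (Sum.inl_injective h)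
  obtain ⟨G, hG⟩ := H.spanningTree.exists_marking H.relGraph (by
    intro j i
    by_cases h : i.1 = 0
    · refine ⟨D.initialArcs j, D.arc j (Fin.last _), dif_pos h, ?_, ?_⟩
      · intro (d : D.Edge s × Bool) (hd : d ∈ D.initialArcs j)
        rw [initialArcs, List.mem_append, List.mem_ofFn] at hd
        rcases hd with hd | ⟨t, rfl⟩
        · rw [entryArcs] at hd
          split_ifs at hd with hf
          · obtain rfl : d = _ := by simpa using hd
            exact ⟨Sum.inr ⟨j, hf⟩, Sum.inr_ne_inl, rfl⟩
          · simp at hd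
        · obtain ⟨x, hx, hx'⟩ := H.arc_parent j t
          exact ⟨Sum.inl x, hroot x hx, hx'⟩
      · rintro ⟨x | j', hx, hx'⟩
        · rcases H.parent_form x fun h => hx (congrArg Sum.inl h) with ⟨j', t, ht⟩ | ⟨e, he⟩
          · have h1 := ht.symm.trans hx'
            simp only [arc, Sum.inl.injEq, Sigma.mk.injEq] at h1
            obtain ⟨rfl, h1⟩ := h1
            exact (Fin.castSucc_lt_last t).ne (eq_of_heq h1)
          · have h1 := he.symm.trans hx'
            simp [extra, arc] at h1
        · have h1 : (D.entry j' : D.Edge s) = D.arc j (Fin.last _) := hx'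
          simp [entry, arc] at h1
    · refine ⟨[], D.petalLoop j ⟨i.1 - 1, by omega⟩, dif_neg h, by simp, ?_⟩
      rintro ⟨x | j', hx, hx'⟩
      · rcases H.parent_form x fun h => hx (congrArg Sum.inl h) with ⟨j', t, ht⟩ | ⟨e, he⟩
        · have h1 := ht.symm.trans hx'
          simp [arc, petalLoop] at h1
        · have h1 := he.symm.trans hx'
          simp [extra, petalLoop] at h1
      · have h1 : (D.entry j' : D.Edge s) = D.petalLoop j ⟨i.1 - 1, by omega⟩ := hx'
        simp [entry, petalLoop] at h1)
  refine ⟨G, ?_, ?_⟩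
  · rw [hG]
    intro e
    -- Edges of petals lie on embedded circles and cannot separate; only the extra edges need the
    -- hypothesis `hex`.
    by_cases he : D.owner e = none
    · rcases e with (⟨j, i⟩ | ⟨j, hj⟩) | (⟨j, i⟩ | e)
      · simp [owner] at he
      · simp [owner] at he
      · simp [owner] at he
      · exact hex e
    · obtain ⟨j, i, h⟩ := D.mem_petal_of_owner_ne_none H.one_le he
      exact not_isSeparating_of_mem (D.isPath_petal j i) (edges_nodup j i) h
  · rw [← D.card_edge H.one_le, hG]
    rfl

end Valid

end Blueprint

/-! ### The star, extremal for `n = ∑ s j`. -/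

namespace Blueprint

theorem corner_of_le {k : ℕ} (D : Blueprint k) {j : Fin k} {i : ℕ} (h : i ≤ D.r j) :
    D.corner j i = Sum.inl (D.pt j i) := if_pos h

theorem corner_of_lt {k : ℕ} (D : Blueprint k) {j : Fin k} {i : ℕ} (h : D.r j < i) :
    D.corner j i = D.base j := if_neg (by omega)

/-- Each wedge contributes an incoming half edge at its first point. -/
theorem exists_dart_pt_zero {k : ℕ} (D : Blueprint k) {s : Fin k → ℕ} (j : Fin k) :
    ∃ d : (D.graph s).Dart, (D.graph s).start d = Sum.inl (D.pt j 0) ∧ d.2 = false ∧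
      D.owner d.1 = some (j, 0) := by
  by_cases h : D.flag j = true
  · exact ⟨(D.entry ⟨j, h⟩, false), D.corner_of_le (Nat.zero_le _), rfl, rfl⟩
  · refine ⟨(D.arc j (Fin.last _), false), ?_, rfl, rfl⟩
    change D.corner j (D.r j + 1) = _
    rw [D.corner_of_lt (Nat.lt_succ_self _), D.base_eq_corner j h, D.corner_of_le (Nat.zero_le _)]

/-- The first wedge meets all other wedges in different points, and there are no other edges. -/
abbrev star (k : ℕ) (s : Fin (k + 1) → ℕ) : Blueprint (k + 1) where
  -- There are `k + 1` wedges and `k` points, but still one point when `k = 0`.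
  X := Fin (k - 1 + 1)
  Extra := Empty
  esrc := Empty.elim
  etgt := Empty.elim
  r j := if j.1 = 0 then k - 1 else 0
  pt j i := Fin.ofNat _ (if j.1 = 0 then i else j.1 - 1)
  -- For a single wedge a separate basepoint would leave the only point with valence 2.
  flag j := decide (2 ≤ s j ∧ 1 ≤ k)

theorem star_three_le_valence {k : ℕ} {s : Fin (k + 1) → ℕ} (hs : 2 ≤ ∑ j, s j)
    (x : (star k s).X) : 3 ≤ ((star k s).graph s).valence (Sum.inl x) := by
  rcases Nat.eq_zero_or_pos k with rfl | hk
  · obtain rfl : x = (0 : Fin (0 - 1 + 1)) := Fin.ext (by have := x.2; omega)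
    have h2 : 2 ≤ s 0 := by simpa using hs
    have hb : (star 0 s).base 0 = Sum.inl (0 : Fin (0 - 1 + 1)) := by
      rw [base_eq_corner _ _ (by simp), corner_of_le _ (Nat.zero_le _)]
      rfl
    refine three_le_valence_of_darts (Γ := (star 0 s).graph s) ((star 0 s).arc 0 0, true)
      ((star 0 s).arc 0 0, false) ((star 0 s).petalLoop 0 ⟨0, by omega⟩, true) rfl hb hb
      (by simp) ?_ ?_
    all_goals
      intro h
      have h3 : ((star 0 s).arc 0 0 : (star 0 s).Edge s) = (star 0 s).petalLoop 0 ⟨0, by omega⟩ :=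
        congrArg Prod.fst h
      simp [arc, petalLoop] at h3
  · have hx : x.1 < k := by have := x.2; omega
    let j : Fin (k + 1) := ⟨x.1 + 1, by omega⟩
    have hj : (star k s).pt j 0 = x := by
      apply Fin.ext
      change (if x.1 + 1 = 0 then 0 else x.1 + 1 - 1) % (k - 1 + 1) = x.1
      rw [if_neg (by omega), Nat.add_sub_cancel, Nat.mod_eq_of_lt x.2]
    have h0 : (star k s).pt 0 x.1 = x := by
      apply Fin.ext
      change x.1 % (k - 1 + 1) = x.1
      rw [Nat.mod_eq_of_lt x.2]
    have hr : x.1 ≤ (star k s).r 0 := by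
      change x.1 ≤ k - 1
      omega
    obtain ⟨d, hd1, hd2, hd3⟩ := (star k s).exists_dart_pt_zero (s := s) j
    refine three_le_valence_of_darts (Γ := (star k s).graph s)
      ((star k s).arc 0 ⟨x.1, Nat.lt_succ_of_le hr⟩, true) ((star k s).arc j 0, true) d
      ?_ ?_ (hd1.trans (congrArg Sum.inl hj)) ?_ ?_ ?_
    · exact ((star k s).corner_of_le hr).trans (congrArg Sum.inl h0)
    · exact ((star k s).corner_of_le (Nat.zero_le _)).trans (congrArg Sum.inl hj)
    · intro h
      have h3 := congrArg (fun d : (star k s).Edge s × Bool => (star k s).owner d.1) h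
      simp only [owner, arc, Sum.elim_inl, Option.some_inj, Prod.mk.injEq, and_true] at h3
      have := congrArg Fin.val h3
      simp [j] at this
    · intro h
      rw [← h] at hd2
      simp at hd2
    · intro h
      rw [← h] at hd2
      simp at hd2

def starValid {k : ℕ} {s : Fin (k + 1) → ℕ} (h1 : ∀ j, 1 ≤ s j) (hs : 2 ≤ ∑ j, s j) :
    Valid (star k s) s (∑ j, s j) where
  one_le := h1
  two_le j hj := (of_decide_eq_true hj).1
  rank := by
    have h : ∑ j : Fin (k + 1), (if j.1 = 0 then k - 1 else 0) = k - 1 := by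
      rw [Fin.sum_univ_succ]
      simp
    rw [h]
    simp
    omega
  pt_inj j i i' hi hi' h := by
    by_cases hj : j.1 = 0
    · simp only [hj, if_true] at hi hi' h
      have h2 := congrArg Fin.val h
      change i % (k - 1 + 1) = i' % (k - 1 + 1) at h2
      rwa [Nat.mod_eq_of_lt (by omega), Nat.mod_eq_of_lt (by omega)] at h2
    · simp only [hj, if_false] at hi hi'
      omega
  valence := star_three_le_valence hs
  -- Every point lies on the first wedge, and any other wedge contains just one point.
  up _ := 0
  up_le _ _ _ := Nat.zero_le _
  up_unique j i hi i' hi' h _ := by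
    have hj : ¬ j.1 = 0 := fun hj => h hj.symm
    simp only [hj, if_false] at hi hi' ⊢
  root := 0
  -- The tree on the points is the first circle of wedge 0, cut open at its last arc.
  parent x := ((star k s).arc 0 (Fin.ofNat _ (x.1 - 1)), true)
  height x := x.1
  finish_parent x hx := by
    have hx0 : x.1 ≠ 0 := fun h => hx (Fin.ext h)
    have hx2 := x.2
    change (star k s).corner 0 ((x.1 - 1) % (k - 1 + 1) + 1) = Sum.inl x
    rw [Nat.mod_eq_of_lt (by omega), Nat.sub_add_cancel (by omega),
      corner_of_le _ (show x.1 ≤ k - 1 by omega)]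
    congr 1
    apply Fin.ext
    change x.1 % (k - 1 + 1) = x.1
    rw [Nat.mod_eq_of_lt x.2]
  start_parent x hx := by
    have hx0 : x.1 ≠ 0 := fun h => hx (Fin.ext h)
    have hx2 := x.2
    refine ⟨⟨x.1 - 1, by omega⟩, ?_, by change x.1 - 1 < x.1; omega⟩
    change (star k s).corner 0 ((x.1 - 1) % (k - 1 + 1)) = _
    rw [Nat.mod_eq_of_lt (by omega), corner_of_le _ (show x.1 - 1 ≤ k - 1 by omega)]
    congr 1
    apply Fin.ext
    change (x.1 - 1) % (k - 1 + 1) = x.1 - 1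
    rw [Nat.mod_eq_of_lt (by omega)]
  parent_form x hx := by
    have hx0 : x.1 ≠ 0 := fun h => hx (Fin.ext h)
    have hx2 := x.2
    refine Or.inl ⟨0, ⟨x.1 - 1, show x.1 - 1 < k - 1 by omega⟩, ?_⟩
    refine congrArg ((star k s).arc 0) (Fin.ext ?_)
    change (x.1 - 1) % (k - 1 + 1) = x.1 - 1
    rw [Nat.mod_eq_of_lt (by omega)]
  arc_parent j i := by
    have hj : j = 0 := by
      by_contra hj
      have hj' : ¬ j.1 = 0 := fun h => hj (Fin.ext h)
      have := i.2
      simp only [hj', if_false] at this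
      omega
    subst hj
    have hi : i.1 < k - 1 := i.2
    refine ⟨⟨i.1 + 1, by omega⟩, fun h => by simpa using congrArg Fin.val h, ?_⟩
    refine congrArg ((star k s).arc 0) (Fin.ext ?_)
    change (i.1 + 1 - 1) % (k - 1 + 1) = i.1
    rw [Nat.add_sub_cancel, Nat.mod_eq_of_lt (by omega)]

end Blueprint

theorem exists_reduced_of_eq {n k : ℕ} (hn : 2 ≤ n) {s : Fin k → ℕ} (hs : ∀ j, 1 ≤ s j)
    (h : n = ∑ j, s j) : ∃ G : MarkedGraph n s, (∀ e, ¬ G.IsSeparating e) ∧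
      G.polysimplexDim + (Finset.univ.filter fun j => s j = 1).card + 2 = 2 * k := by
  subst h
  rcases k with _ | k
  · simp at hn
  obtain ⟨G, h1, h2⟩ := (Blueprint.starValid hs hn).exists_markedGraph fun e => e.elim
  refine ⟨G, h1, ?_⟩
  have h3 := G.polysimplexDim_of_outside_eq_empty (G.outside_eq_empty_of_reduced rfl h1)
  have h4 : ∑ j : Fin (k + 1), (if j.1 = 0 then k - 1 else 0) = k - 1 := by
    rw [Fin.sum_univ_succ]
    simp
  rw [h4, Fintype.card_empty] at h2
  have h5 := Finset.card_filter_add_card_filter_not (s := Finset.univ) (fun j => s j = 1)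
  rw [Finset.card_univ, Fintype.card_fin] at h5
  -- A single wedge is a rose: one vertex, dimension zero.
  rcases Nat.eq_zero_or_pos k with rfl | hk
  · have h6 : (Finset.univ.filter fun j => s j = 1).card = 0 := by
      rw [Finset.card_eq_zero, Finset.filter_eq_empty_iff]
      intro j _
      rw [show j = 0 from Fin.ext (by omega)]
      have : 2 ≤ s 0 := by simpa using hn
      omega
    have h7 : (Finset.univ.filter fun j =>
        decide (2 ≤ s j ∧ 1 ≤ 0) = true).card = 0 := by simp
    rw [h7] at h2
    omega
  · have h6 : (Finset.univ.filter fun j => decide (2 ≤ s j ∧ 1 ≤ k) = true) =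
        Finset.univ.filter fun j => ¬ s j = 1 := by
      refine Finset.filter_congr fun j _ => ?_
      have := hs j
      rw [decide_eq_true_iff]
      omega
    rw [h6] at h2
    omega

/-! ### The necklace, extremal for `n > ∑ s j`. -/

namespace Blueprint

theorem extra_injective {k : ℕ} (D : Blueprint k) {s : Fin k → ℕ} :
    Function.Injective (D.extra (s := s)) :=
  Sum.inr_injective.comp Sum.inr_injective

theorem ofNat_add_one (K a : ℕ) : Fin.ofNat (K + 1) a + 1 = Fin.ofNat (K + 1) (a + 1) := by
  apply Fin.ext
  simp [Fin.val_add]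

/-- The wedges and `b` digons are arranged in a ring of `K + 1 = k + b` pieces; the piece `g` is
entered at the point `(g, false)` and left at the point `(g, true)`. -/
abbrev necklace {k : ℕ} (s : Fin k → ℕ) (b K : ℕ) (hK : K + 1 = k + b) : Blueprint k where
  X := Fin (K + 1) × Bool
  Extra := Fin (K + 1) ⊕ (Fin b × Bool)
  esrc := Sum.elim (fun g => (g, true)) fun p => (⟨k + p.1.1, by omega⟩, false)
  etgt := Sum.elim (fun g => (g + 1, false)) fun p => (⟨k + p.1.1, by omega⟩, true)
  r _ := 1
  pt j i := (⟨j.1, by omega⟩, decide (i = 1))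
  flag j := decide (2 ≤ s j)

variable {k : ℕ} {s : Fin k → ℕ} {b K : ℕ} (hK : K + 1 = k + b)

theorem necklace_three_le_valence (x : (necklace s b K hK).X) :
    3 ≤ ((necklace s b K hK).graph s).valence (Sum.inl x) := by
  let D := necklace s b K hK
  obtain ⟨g, c⟩ := x
  by_cases hg : g.1 < k
  · let j : Fin k := ⟨g.1, hg⟩
    cases c
    · obtain ⟨d, hd1, hd2, hd3⟩ := D.exists_dart_pt_zero (s := s) j
      refine three_le_valence_of_darts (Γ := D.graph s) (D.extra (Sum.inl (g - 1)), false)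
        (D.arc j 0, true) d ?_ ?_ hd1 ?_ ?_ ?_
      · change (Sum.inl (g - 1 + 1, false) : D.Vert) = _
        rw [sub_add_cancel]
      · exact D.corner_of_le (Nat.zero_le _)
      · simp
      · intro h
        rw [← h] at hd3
        simp [owner, extra] at hd3
      · intro h
        rw [← h] at hd2
        simp at hd2
    · refine three_le_valence_of_darts (Γ := D.graph s) (D.extra (Sum.inl g), true)
        (D.arc j 1, true) (D.arc j 0, false) rfl ?_ ?_ ?_ (by simp) (by simp)
      · exact D.corner_of_le le_rfl
      · exact D.corner_of_le le_rfl
      · intro h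
        have h3 : (D.extra (Sum.inl g) : D.Edge s) = D.arc j 1 := congrArg Prod.fst h
        simp [extra, arc] at h3
  · let i : Fin b := ⟨g.1 - k, by omega⟩
    have hi : (⟨k + i.1, by omega⟩ : Fin (K + 1)) = g := Fin.ext (by simp [i]; omega)
    have hne : (D.extra (Sum.inr (i, true)) : D.Edge s) ≠ D.extra (Sum.inr (i, false)) := by
      intro h
      have h1 : (Sum.inr (i, true) : Fin (K + 1) ⊕ (Fin b × Bool)) = Sum.inr (i, false) :=
        D.extra_injective h
      simp at h1
    cases c
    · refine three_le_valence_of_darts (Γ := D.graph s) (D.extra (Sum.inl (g - 1)), false)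
        (D.extra (Sum.inr (i, true)), true) (D.extra (Sum.inr (i, false)), true) ?_ ?_ ?_
        (by simp) (by simp) fun h => hne (congrArg Prod.fst h)
      · change (Sum.inl (g - 1 + 1, false) : D.Vert) = _
        rw [sub_add_cancel]
      · exact congrArg (fun g => Sum.inl (g, false)) hi
      · exact congrArg (fun g => Sum.inl (g, false)) hi
    · refine three_le_valence_of_darts (Γ := D.graph s) (D.extra (Sum.inl g), true)
        (D.extra (Sum.inr (i, true)), false) (D.extra (Sum.inr (i, false)), false) rfl ?_ ?_
        (by simp) (by simp) fun h => hne (congrArg Prod.fst h)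
      · exact congrArg (fun g => Sum.inl (g, true)) hi
      · exact congrArg (fun g => Sum.inl (g, true)) hi

/-- An edge from the entry to the exit of a piece of the necklace. -/
def necklaceEdge (g : Fin (K + 1)) : (necklace s b K hK).Edge s :=
  if hg : g.1 < k then (necklace s b K hK).arc ⟨g.1, hg⟩ 0
  else (necklace s b K hK).extra (Sum.inr (⟨g.1 - k, by omega⟩, true))

theorem necklaceEdge_start (g : Fin (K + 1)) : ((necklace s b K hK).graph s).start
    (necklaceEdge hK g, true) = Sum.inl (g, false) := by
  rw [necklaceEdge]
  split_ifs with hg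
  · exact corner_of_le _ (Nat.zero_le _)
  · exact congrArg (fun g => Sum.inl (g, false)) (Fin.ext (by simp; omega))

theorem necklaceEdge_finish (g : Fin (K + 1)) : ((necklace s b K hK).graph s).finish
    (necklaceEdge hK g, true) = Sum.inl (g, true) := by
  rw [necklaceEdge]
  split_ifs with hg
  · exact corner_of_le (necklace s b K hK) (j := ⟨g.1, hg⟩) (i := 1) le_rfl
  · exact congrArg (fun g => Sum.inl (g, true)) (Fin.ext (by simp; omega))

theorem necklaceEdge_ne (g g' : Fin (K + 1)) :
    (necklaceEdge hK g : (necklace s b K hK).Edge s) ≠ (necklace s b K hK).extra (Sum.inl g') := by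
  rw [necklaceEdge]
  split_ifs with hg <;> simp [arc, extra]

/-- A connecting edge is bypassed by going around the rest of the ring; an edge of a digon forms a
circle with its twin. -/
theorem necklace_not_isSeparating (e : (necklace s b K hK).Extra) :
    ¬ ((necklace s b K hK).graph s).IsSeparating ((necklace s b K hK).extra e) := by
  let D := necklace s b K hK
  rcases e with g | ⟨i, c⟩
  · have key : ∀ t ≤ K, ∃ L, (D.graph s).IsPath (Sum.inl (g + 1, false)) L
        (Sum.inl (Fin.ofNat (K + 1) (g.1 + 1 + t), true)) ∧
        ∀ d ∈ L, d.1 ≠ D.extra (Sum.inl g) := by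
      intro t
      induction t with
      | zero =>
        intro _
        have hg : g + 1 = Fin.ofNat (K + 1) (g.1 + 1) := by
          apply Fin.ext
          simp [Fin.val_add]
        refine ⟨[(necklaceEdge hK (g + 1), true)], ?_, ?_⟩
        · rw [add_zero, ← hg]
          exact ⟨necklaceEdge_start hK _, necklaceEdge_finish hK _⟩
        · intro d hd
          rw [List.mem_singleton.mp hd]
          exact necklaceEdge_ne hK _ _
      | succ t ih =>
        intro ht
        obtain ⟨L, hL, hne⟩ := ih (by omega)
        refine ⟨L ++ [(D.extra (Sum.inl (Fin.ofNat (K + 1) (g.1 + 1 + t))), true),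
          (necklaceEdge hK (Fin.ofNat (K + 1) (g.1 + 1 + (t + 1))), true)], hL.append ?_, ?_⟩
        · refine ⟨rfl, ?_, necklaceEdge_finish hK _⟩
          rw [necklaceEdge_start]
          change _ = (Sum.inl (Fin.ofNat (K + 1) (g.1 + 1 + t) + 1, false) : D.Vert)
          rw [ofNat_add_one]
          rfl
        · intro d hd
          simp only [List.mem_append, List.mem_cons, List.not_mem_nil, or_false] at hd
          rcases hd with hd | rfl | rfl
          · exact hne d hd
          · intro h
            -- The removed connection would be reached only after all `K + 1` pieces, i.e. for `t =
            -- K`.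
            have h1 : Fin.ofNat (K + 1) (g.1 + 1 + t) = g :=
              Sum.inl_injective (D.extra_injective h)
            have h2 : (g.1 + 1 + t) % (K + 1) = g.1 := congrArg Fin.val h1
            have h3 := g.2
            rcases Nat.lt_or_ge (g.1 + 1 + t) (K + 1) with h4 | h4
            · rw [Nat.mod_eq_of_lt h4] at h2
              omega
            · rw [Nat.mod_eq_sub_mod h4, Nat.mod_eq_of_lt (by omega)] at h2
              omega
          · exact necklaceEdge_ne hK _ _
    obtain ⟨L, hL, hne⟩ := key K le_rfl
    have hg : Fin.ofNat (K + 1) (g.1 + 1 + K) = g := by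
      apply Fin.ext
      change (g.1 + 1 + K) % (K + 1) = g.1
      rw [show g.1 + 1 + K = g.1 + (K + 1) by omega, Nat.add_mod_right, Nat.mod_eq_of_lt g.2]
    rw [hg] at hL
    refine fun h => h ⟨_, hL.invRev, fun d hd => ?_⟩
    rw [FreeGroup.invRev, List.mem_reverse, List.mem_map] at hd
    obtain ⟨d', hd', rfl⟩ := hd
    exact hne d' hd'
  · have h1 : (D.graph s).IsPath ((D.graph s).src (D.extra (Sum.inr (i, c))))
        [(D.extra (Sum.inr (i, c)), true), (D.extra (Sum.inr (i, !c)), false)]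
        ((D.graph s).src (D.extra (Sum.inr (i, c)))) := ⟨rfl, rfl, rfl⟩
    refine not_isSeparating_of_mem h1 ?_ List.mem_cons_self
    have h2 : (Sum.inr (i, c) : Fin (K + 1) ⊕ (Fin b × Bool)) ≠ Sum.inr (i, !c) := by simp
    simpa using D.extra_injective.ne h2

def necklaceValid (hs : ∀ j, 1 ≤ s j) :
    Valid (necklace s b K hK) s (∑ j, s j + b + 1) where
  one_le := hs
  two_le j hj := of_decide_eq_true hj
  rank := by
    simp
    omega
  pt_inj j i i' hi hi' h := by
    have h1 := congrArg Prod.snd h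
    have hi : i ≤ 1 := hi
    have hi' : i' ≤ 1 := hi'
    have h2 : i = 1 ↔ i' = 1 := by simpa using h1
    omega
  valence := necklace_three_le_valence hK
  -- The wedges are pairwise disjoint, so each point takes the index of its own piece.
  up x := x.1.1
  up_le _ _ _ := le_rfl
  up_unique _ _ _ _ _ h _ := (h rfl).elim
  root := (0, false)
  -- The tree runs once around the ring, with one edge through each piece, and omits the connection
  -- back into the root.
  parent x := if x.2 then (necklaceEdge hK x.1, true)
    else ((necklace s b K hK).extra (Sum.inl (x.1 - 1)), true)
  height x := 2 * x.1.1 + if x.2 then 1 else 0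
  finish_parent := by
    rintro ⟨g, c⟩ hx
    cases c
    · change (Sum.inl (g - 1 + 1, false) : (necklace s b K hK).Vert) = _
      rw [sub_add_cancel]
    · exact necklaceEdge_finish hK g
  start_parent := by
    rintro ⟨g, c⟩ hx
    cases c
    · refine ⟨(g - 1, true), rfl, ?_⟩
      have hg : g ≠ 0 := fun h => hx (by rw [h])
      have h1 := Fin.val_sub_one_of_ne_zero hg
      have h2 : g.1 ≠ 0 := fun h => hg (Fin.ext h)
      simp
      omega
    · exact ⟨(g, false), necklaceEdge_start hK g, by simp⟩
  parent_form := by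
    rintro ⟨g, c⟩ hx
    cases c
    · exact Or.inr ⟨_, rfl⟩
    · change (∃ j, ∃ i : Fin 1, necklaceEdge hK g = _) ∨ ∃ e, necklaceEdge hK g = _
      rw [necklaceEdge]
      split_ifs with hg
      · exact Or.inl ⟨_, 0, rfl⟩
      · exact Or.inr ⟨_, rfl⟩
  arc_parent j i := by
    refine ⟨(⟨j.1, by omega⟩, true), by simp, ?_⟩
    have hi : i = 0 := Subsingleton.elim (α := Fin 1) _ _
    subst hi
    change necklaceEdge hK ⟨j.1, _⟩ = _
    rw [necklaceEdge, dif_pos j.2]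
    rfl

end Blueprint

/-- All valence estimates are sharp for the necklace: valence 3 at the points and `2 s j` at the
separate basepoints. -/
theorem exists_reduced_of_lt {n k : ℕ} (hn : 2 ≤ n) {s : Fin k → ℕ} (hs : ∀ j, 1 ≤ s j)
    (h : ∑ j, s j < n) : ∃ G : MarkedGraph n s, (∀ e, ¬ G.IsSeparating e) ∧
      G.polysimplexDim + 3 * ∑ j, s j + (Finset.univ.filter fun j => s j = 1).card + 4 =
        3 * n + 3 * k := by
  -- The ring itself accounts for one unit of the excess rank, the `b` digons for the rest.
  obtain ⟨b, rfl⟩ : ∃ b, n = ∑ j, s j + b + 1 := ⟨n - ∑ j, s j - 1, by omega⟩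
  obtain ⟨K, hK⟩ : ∃ K, K + 1 = k + b := by
    refine ⟨k + b - 1, Nat.sub_add_cancel ?_⟩
    rcases k with _ | k
    · simp at hn
      omega
    · omega
  obtain ⟨G, h1, h2⟩ := (Blueprint.necklaceValid hK hs).exists_markedGraph
    (Blueprint.necklace_not_isSeparating hK)
  refine ⟨G, h1, ?_⟩
  have h3 := G.polysimplexDim_of_outside_nonempty (G.outside_nonempty hs h)
  have h5 := Finset.card_filter_add_card_filter_not (s := Finset.univ) (fun j => s j = 1)
  rw [Finset.card_univ, Fintype.card_fin] at h5
  have h6 : (Finset.univ.filter fun j => decide (2 ≤ s j) = true) =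
      Finset.univ.filter fun j => ¬ s j = 1 := by
    refine Finset.filter_congr fun j _ => ?_
    have := hs j
    rw [decide_eq_true_iff]
    omega
  rw [h6] at h2
  simp only [Finset.sum_const, Finset.card_univ, Fintype.card_fin, smul_eq_mul, mul_one,
    Fintype.card_sum, Fintype.card_prod, Fintype.card_bool] at h2
  omega

end RelOuter

/-! ### Comparison of the bounds with the examples. -/

theorem mainTheorem7 (n k : ℕ) (hn : 2 ≤ n) (s : Fin k → ℕ) (hs : ∀ j, 1 ≤ s j) (m : ℕ)
    (hm : m = (Finset.univ.filter fun j => s j = 1).card) :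
    (∑ j, s j < n → ∃ d : ℕ,
      (d : ℤ) = 3 * n + 3 * k - 3 * ∑ j, (s j : ℤ) - 4 - m ∧
      RelOuter.RelOuterSpace.dim (Set.univ : Set (RelOuter.RelOuterSpace n s)) = (d : ℕ∞) ∧
      RelOuter.RelOuterSpace.dim (RelOuter.RelOuterSpace.reduced n s) = (d : ℕ∞)) ∧
    (n = ∑ j, s j → ∃ d : ℕ,
      (d : ℤ) = 3 * n + 2 * k - 3 * ∑ j, (s j : ℤ) - 2 - m ∧
      RelOuter.RelOuterSpace.dim (RelOuter.RelOuterSpace.reduced n s) = (d : ℕ∞)) := by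
  have hcast : ∑ j, (s j : ℤ) = ((∑ j, s j : ℕ) : ℤ) := by push_cast; rfl
  rw [hcast]
  constructor
  · intro h
    obtain ⟨G, h1, h2⟩ := RelOuter.exists_reduced_of_lt hn hs h
    have h3 : ∀ H : RelOuter.MarkedGraph n s, H.polysimplexDim ≤ G.polysimplexDim := fun H => by
      have := H.polysimplexDim_le hs h
      omega
    exact ⟨G.polysimplexDim, by omega,
      RelOuter.RelOuterSpace.dim_eq G (Set.subset_univ _) fun H _ => h3 H,
      RelOuter.RelOuterSpace.dim_eq G
        ((RelOuter.RelOuterSpace.openPolysimplex_subset_reduced_iff G).mpr h1) fun H _ => h3 H⟩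
  · intro h
    obtain ⟨G, h1, h2⟩ := RelOuter.exists_reduced_of_eq hn hs h
    refine ⟨G.polysimplexDim, by omega, RelOuter.RelOuterSpace.dim_eq G
      ((RelOuter.RelOuterSpace.openPolysimplex_subset_reduced_iff G).mpr h1) fun H hH => ?_⟩
    have := H.polysimplexDim_le_of_reduced hn hs h
      ((RelOuter.RelOuterSpace.openPolysimplex_subset_reduced_iff H).mp hH)
    omega
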